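/- **Setting.** Let $(\Omega,\mathcal A,\mathbb P)$ be a probability space, $T>0$, and let $\mathcal F_t=\sigma(Z_1(s),\dots,Z_m(s);\,0\le s\le t)$ be the filtration generated by finitely many real-valued processes. In the tick-time stochastic volatility model the log-price is $$P(t)=P(0)+\int_0^t\varsigma(r)\,dB(N(r))=P(0)+\sum_{0<t_i\le t}\varsigma(t_i)U_i,\qquad U_i=B(N(t_i))-B(N(t_{i-1})),$$ where $N$ is an $\mathcal F_t$-adapted counting process ($N(0)=0$, right-continuous paths, unit jumps at the arrival times $t_1<t_2<\dots$; $t_0:=0$) with a positive, $\mathcal F_t$-predictable $\mathcal F_t$-intensity $\lambda$ that is left-continuous with right-hand limits and satisfies $\int_0^t\lambda(s)\,ds<\infty$ a.s. for all $t$; $B$ is a Brownian motion such that $B(N(t))$ is $\mathcal F_t$-adapted; and $\varsigma$ is a positive, continuous, $\mathcal F_t$-predictable process. Assume that * $B$ is independent of the processes $(\lambda,\varsigma,N)$; * for all $t\in[0,T]$, $\mathbb E[\int_t^T\varsigma^2(r)\lambda(r)\,dr\mid\mathcal F_t]<\infty$ a.s., $\mathbb E[\varsigma^4(t)]<\infty$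 and $\mathbb E[\int_0^t\varsigma^4(r)\lambda(r)\,dr]<\infty$. Put $\operatorname{IV}(s,t)=\int_s^t\varsigma^2(r)\lambda(r)\,dr$, $\operatorname{rIV}(s,t)=\sum_{s<t_i\le t}\varsigma^2(t_i)$, $\mathcal G^{\lambda,\varsigma}=\sigma(\lambda(s),\varsigma(s);\,0\le s\le T)$ and $\mathcal G^{\lambda,\varsigma,N}=\sigma(\lambda(s),\varsigma(s),N(s);\,0\le s\le T)$. Fix an integer $M\ge1$. For a sub-$\sigma$-algebra $\mathcal G$, a $\mathcal G$-measurable sampling scheme is a vector $\tau=(\tau_0,\dots,\tau_M)$ of $\mathcal G$-measurable times with $0=\tau_0<\tau_1<\dots<\tau_M=T$ a.s. Its realized variance is $\operatorname{RV}(\tau)=\sum_{j=1}^M(P(\tau_j)-P(\tau_{j-1}))^2$, and $$\operatorname{MSE}_{\mathcal G}(\tau)=\mathbb E\big[(\operatorname{RV}(\tau)-\operatorname{IV}(0,T))^2\,\big|\,\mathcal G\big],$$ the conditional expectation of a nonnegative random variable, with values in $[0,\infty]$. Intensity business time sampling is $\tau^{\rm iBTS}_j=\inf\{t\in[0,T]:\,T\operatorname{IV}(0,t)/\operatorname{IV}(0,T)\ge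 jT/M\}$. Realized business time sampling is $\tau^{\rm rBTS}_j=\inf\{t\in[0,T]:\,T\operatorname{rIV}(0,t)/\operatorname{rIV}(0,T)\ge jT/M\}$ for $j<M$, $\tau^{\rm rBTS}_M=T$. Call times $\tau$ *equidistant in realized IV* at an outcome if $\operatorname{rIV}(\tau_{j-1},\tau_j)=\operatorname{rIV}(0,T)/M$ there for $j=1,\dots,M$. Let $E$ be the event that $\operatorname{rIV}(0,T)>0$ and $\tau^{\rm rBTS}$ is equidistant in realized IV. **(a)** The times $\tau^{\rm rBTS}_j$ are $\mathcal G^{\lambda,\varsigma,N}$-measurable, and $0=\tau^{\rm rBTS}_0<\dots<\tau^{\rm rBTS}_M=T$ on $E$. For every $\mathcal G^{\lambda,\varsigma,N}$-measurable sampling scheme $\tau$ the following hold for almost every outcome. 1. $\operatorname{MSE}_{\mathcal G^{\lambda,\varsigma,N}}(\tau)\ge(\operatorname{rIV}(0,T)-\operatorname{IV}(0,T))^2+\tfrac2M\operatorname{rIV}(0,T)^2$, with equality at an outcome if and only if $\tau$ is equidistant in realized IV there. 2. On $E$, $\operatorname{MSE}_{\mathcal G^{\lambda,\varsigma,N}}(\tau)\ge\operatorname{MSE}_{\mathcal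 G^{\lambda,\varsigma,N}}(\tau^{\rm rBTS})$, with equality at an outcome if and only if $\tau$ and $\tau^{\rm rBTS}$ split the ticks in the same way there, i.e. $N(\tau_j)=N(\tau^{\rm rBTS}_j)$ for $j=0,\dots,M$. In particular, at outcomes in $E$ where $\tau_1,\dots,\tau_{M-1}$ are arrival times, equality holds if and only if $\tau_j=\tau^{\rm rBTS}_j$ for $j=0,\dots,M$. **(b)** Assume in addition that $\lambda$ has continuous paths and that $N$ is a doubly stochastic Poisson process conditionally on $(\lambda,\varsigma)$: for all $s\le t$, given the processes $\lambda,\varsigma$ and $(N(r))_{r\le s}$, the increment $N(t)-N(s)$ is Poisson distributed with mean $\int_s^t\lambda(r)\,dr$. Then $\tau^{\rm iBTS}$ is a $\mathcal G^{\lambda,\varsigma}$-measurable sampling scheme, and for every $\mathcal G^{\lambda,\varsigma}$-measurable sampling scheme $\tau$, for almost every outcome, $\operatorname{MSE}_{\mathcal G^{\lambda,\varsigma}}(\tau)\ge\operatorname{MSE}_{\mathcal G^{\lambda,\varsigma}}(\tau^{\rm iBTS})$, with equality at an outcome if and only if $\tau_j=\tau^{\rm iBTS}_j$ there for $j=0,\dots,M$.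 -/

import Mathlib

open MeasureTheory ProbabilityTheory Filter Topology
open scoped NNReal ENNReal

namespace TTSV

variable {Ω : Type*}

/-! Time is `ℝ≥0`.  Processes are written `X t ω`.  Throughout, `lam` is the trading intensity
`λ`, `vs` the tick volatility `ς`, `N` the counting process of the ticks, `B` the Brownian motion,
`T` the length of the trading day and `M` the number of sampling intervals. -/

/-! ### Information sets -/

/-- The σ-algebra generated by `X s`, `s ∈ S`. -/
abbrev sigmaOf {E : Type*} [MeasurableSpace E] (X : ℝ≥0 → Ω → E) (S : Set ℝ≥0) :
    MeasurableSpace Ω :=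
  ⨆ s ∈ S, MeasurableSpace.comap (X s) inferInstance

/-- `σ(λ(s), ς(s); s ∈ S)`. -/
abbrev sigmaLV (lam vs : ℝ≥0 → Ω → ℝ) (S : Set ℝ≥0) : MeasurableSpace Ω :=
  sigmaOf lam S ⊔ sigmaOf vs S

/-- `σ(λ(s), ς(s), N(s); s ∈ S)`. -/
abbrev sigmaLVN (lam vs : ℝ≥0 → Ω → ℝ) (N : ℝ≥0 → Ω → ℕ) (S : Set ℝ≥0) : MeasurableSpace Ω :=
  sigmaLV lam vs S ⊔ sigmaOf N S

/-! ### Ticks, price, integrated variances -/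

/-- The `i`-th arrival time `t_i = inf {t : N(t) ≥ i}` (so `t_0 = 0`); meaningful when `N` reaches
`i`. -/
noncomputable def arrival (N : ℝ≥0 → Ω → ℕ) (i : ℕ) (ω : Ω) : ℝ≥0 :=
  sInf {t | i ≤ N t ω}

/-- The sum of `f i` over all ticks with `s < t_i ≤ t`. -/
def tickSum (N : ℝ≥0 → Ω → ℕ) (f : ℕ → Ω → ℝ) (s t : ℝ≥0) (ω : Ω) : ℝ :=
  ∑ i ∈ Finset.Ioc (N s ω) (N t ω), f i ω

/-- The Brownian increment `U_i = B(N(t_i)) - B(N(t_{i-1}))` of the `i`-th tick. -/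
noncomputable def tickShock (N : ℝ≥0 → Ω → ℕ) (B : ℝ≥0 → Ω → ℝ) (i : ℕ) (ω : Ω) : ℝ :=
  B (N (arrival N i ω) ω) ω - B (N (arrival N (i - 1) ω) ω) ω

/-- The log-price `P(t) = P(0) + ∫_0^t ς(r) dB(N(r)) = P(0) + ∑_{0 < t_i ≤ t} ς(t_i) U_i`. -/
noncomputable def logPrice (P₀ : Ω → ℝ) (vs : ℝ≥0 → Ω → ℝ) (N : ℝ≥0 → Ω → ℕ)
    (B : ℝ≥0 → Ω → ℝ) (t : ℝ≥0) (ω : Ω) : ℝ :=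
  P₀ ω + tickSum N (fun i ω => vs (arrival N i ω) ω * tickShock N B i ω) 0 t ω

/-- Integrated variance `IV(s,t) = ∫_s^t ς²(r) λ(r) dr`. -/
noncomputable def IV (lam vs : ℝ≥0 → Ω → ℝ) (s t : ℝ≥0) (ω : Ω) : ℝ :=
  ∫ r in (s : ℝ)..(t : ℝ), vs r.toNNReal ω ^ 2 * lam r.toNNReal ω

/-- Realized integrated variance `rIV(s,t) = ∫_{(s,t]} ς²(r) dN(r) = ∑_{s < t_i ≤ t} ς²(t_i)`. -/
noncomputable def rIV (vs : ℝ≥0 → Ω → ℝ) (N : ℝ≥0 → Ω → ℕ) (s t : ℝ≥0) (ω : Ω) : ℝ :=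
  tickSum N (fun i ω => vs (arrival N i ω) ω ^ 2) s t ω

/-! ### Sampling schemes and the realized variance -/

/-- `0 = τ_0 < τ_1 < … < τ_M = T` at the outcome `ω` (entries with index above `M` are
irrelevant). -/
def IsGridAt (T : ℝ≥0) (M : ℕ) (τ : ℕ → Ω → ℝ≥0) (ω : Ω) : Prop :=
  τ 0 ω = 0 ∧ τ M ω = T ∧ ∀ j < M, τ j ω < τ (j + 1) ω

/-- Realized variance `RV(τ) = ∑_{j=1}^M (P(τ_j) - P(τ_{j-1}))²`. -/
def RV (P : ℝ≥0 → Ω → ℝ) (M : ℕ) (τ : ℕ → Ω → ℝ≥0) (ω : Ω) : ℝ :=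
  ∑ j ∈ Finset.range M, (P (τ (j + 1) ω) ω - P (τ j ω) ω) ^ 2

/-- Sampling times of an accumulated sampling intensity `Φ` with `Φ(T) = T`:
`τ_j = inf {t ∈ [0,T] : Φ(t) ≥ j T / M}`, with `τ_M = T`. -/
noncomputable def samplingTimes (Φ : ℝ≥0 → Ω → ℝ) (T : ℝ≥0) (M : ℕ) (j : ℕ) (ω : Ω) : ℝ≥0 :=
  if j = M then T else sInf {t | t ≤ T ∧ (j : ℝ) * T / M ≤ Φ t ω}

/-- Intensity business time sampling: `Φ(t) = T · IV(0,t) / IV(0,T)`. -/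
noncomputable def iBTS (lam vs : ℝ≥0 → Ω → ℝ) (T : ℝ≥0) (M : ℕ) : ℕ → Ω → ℝ≥0 :=
  samplingTimes (fun t ω => T * IV lam vs 0 t ω / IV lam vs 0 T ω) T M

/-- Realized business time sampling: `Φ(t) = T · rIV(0,t) / rIV(0,T)`. -/
noncomputable def rBTS (vs : ℝ≥0 → Ω → ℝ) (N : ℝ≥0 → Ω → ℕ) (T : ℝ≥0) (M : ℕ) :
    ℕ → Ω → ℝ≥0 :=
  samplingTimes (fun t ω => T * rIV vs N 0 t ω / rIV vs N 0 T ω) T M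

/-- At the outcome `ω` the times `τ` are equidistant in realized integrated variance:
`rIV(τ_{j-1}, τ_j) = rIV(0,T) / M` for `j = 1, …, M`. -/
def IsEquidistantRIV (vs : ℝ≥0 → Ω → ℝ) (N : ℝ≥0 → Ω → ℕ) (T : ℝ≥0) (M : ℕ)
    (τ : ℕ → Ω → ℝ≥0) (ω : Ω) : Prop :=
  ∀ j < M, rIV vs N (τ j ω) (τ (j + 1) ω) ω = rIV vs N 0 T ω / M

/-- `t` is one of the arrival times in `[0, T]` at the outcome `ω`. -/
def IsTick (N : ℝ≥0 → Ω → ℕ) (T t : ℝ≥0) (ω : Ω) : Prop :=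
  ∃ i, 1 ≤ i ∧ i ≤ N T ω ∧ t = arrival N i ω

/-! ### The model -/

/-- Paths of a simple, non-explosive counting process: `N(0) = 0`, increasing, right-continuous,
jumps of size one. -/
structure IsCountingProcess (N : ℝ≥0 → Ω → ℕ) : Prop where
  zero : ∀ ω, N 0 ω = 0
  mono : ∀ ω, Monotone fun t => N t ω
  right_cont : ∀ ω t, ContinuousWithinAt (fun s => N s ω) (Set.Ici t) t
  unit_jump : ∀ ω t, ∀ᶠ s in 𝓝[<] t, N t ω ≤ N s ω + 1

variable [MeasurableSpace Ω]

open Classical in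
/-- `lam` is an `F`-intensity of the counting process `N`: for every nonnegative `F`-predictable
process `C`, `E ∫_{(0,∞)} C dN = E ∫_0^∞ C(r) λ(r) dr`. -/
def IsIntensity (μ : Measure Ω) (F : Filtration ℝ≥0 ‹MeasurableSpace Ω›)
    (N : ℝ≥0 → Ω → ℕ) (lam : ℝ≥0 → Ω → ℝ) : Prop :=
  ∀ C : ℝ≥0 → Ω → ℝ≥0∞, Measurable[F.predictable] (Function.uncurry C) →
    ∫⁻ ω, ∑' i : ℕ, (if ∃ t, i + 1 ≤ N t ω then C (arrival N (i + 1) ω) ω else 0) ∂μ =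
      ∫⁻ ω, (∫⁻ r in Set.Ioi (0 : ℝ),
        C r.toNNReal ω * ENNReal.ofReal (lam r.toNNReal ω)) ∂μ

/-- The tick-time stochastic volatility model, with respect to the filtration `F`. -/
structure IsModel (μ : Measure Ω) (F : Filtration ℝ≥0 ‹MeasurableSpace Ω›)
    (lam vs : ℝ≥0 → Ω → ℝ) (N : ℝ≥0 → Ω → ℕ) (B : ℝ≥0 → Ω → ℝ) : Prop where
  counting : IsCountingProcess N
  N_adapted : Adapted F N
  lam_pos : ∀ ω t, 0 < lam t ω
  lam_predictable : IsStronglyPredictable F lam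
  lam_left_cont : ∀ ω t, ContinuousWithinAt (fun s => lam s ω) (Set.Iic t) t
  lam_right_lim : ∀ ω t, ∃ l, Tendsto (fun s => lam s ω) (𝓝[>] t) (𝓝 l)
  lam_integrable : ∀ᵐ ω ∂μ, ∀ t : ℝ≥0,
    IntervalIntegrable (fun r => lam r.toNNReal ω) volume 0 t
  intensity : IsIntensity μ F N lam
  B_measurable : ∀ t, Measurable (B t)
  B_brownian : IsBrownianReal B μ
  BN_adapted : Adapted F fun t ω => B (N t ω) ω
  vs_pos : ∀ ω t, 0 < vs t ω
  vs_cont : ∀ ω, Continuous fun t => vs t ω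
  vs_predictable : IsStronglyPredictable F vs

/-- The Brownian motion is independent of the processes `(λ, ς, N)`. -/
def IsIndependentNoise (μ : Measure Ω) (lam vs : ℝ≥0 → Ω → ℝ) (N : ℝ≥0 → Ω → ℕ)
    (B : ℝ≥0 → Ω → ℝ) : Prop :=
  Indep (sigmaOf B Set.univ) (sigmaLVN lam vs N Set.univ) μ

/-- Moment conditions on `[0, T]`. -/
structure HasMoments (μ : Measure Ω) (F : Filtration ℝ≥0 ‹MeasurableSpace Ω›)
    (lam vs : ℝ≥0 → Ω → ℝ) (T : ℝ≥0) : Prop where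
  cond_iv : ∀ t ≤ T, ∀ᵐ ω ∂μ,
    condLExp (F t) μ (fun ω => ENNReal.ofReal (IV lam vs t T ω)) ω < ∞
  vs_four : ∀ t ≤ T, ∫⁻ ω, ENNReal.ofReal (vs t ω ^ 4) ∂μ < ∞
  iq : ∀ t ≤ T, ∫⁻ ω, ENNReal.ofReal
    (∫ r in (0 : ℝ)..(t : ℝ), vs r.toNNReal ω ^ 4 * lam r.toNNReal ω) ∂μ < ∞

/-- Conditionally on `𝒢`, `N` is an inhomogeneous Poisson process with intensity `lam`: given `𝒢`
and the past of `N` up to time `s`, the increment `N(t) - N(s)` has the Poisson distribution with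
mean `∫_s^t λ(r) dr`. -/
def IsDoublyStochasticPoisson (μ : Measure Ω) (𝒢 : MeasurableSpace Ω)
    (N : ℝ≥0 → Ω → ℕ) (lam : ℝ≥0 → Ω → ℝ) : Prop :=
  ∀ s t : ℝ≥0, s ≤ t → ∀ k : ℕ,
    condExp (𝒢 ⊔ sigmaOf N (Set.Iic s)) μ
        (Set.indicator {ω | N t ω = N s ω + k} fun _ => (1 : ℝ))
      =ᵐ[μ] fun ω =>
        Real.exp (-∫ r in (s : ℝ)..(t : ℝ), lam r.toNNReal ω) *
          (∫ r in (s : ℝ)..(t : ℝ), lam r.toNNReal ω) ^ k / (k.factorial : ℝ)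

/-- The Poisson assumption: `λ` has continuous paths and, conditionally on the processes `(λ, ς)`,
the counting process `N` is Poisson with intensity `λ`. -/
structure HasPoissonArrivals (μ : Measure Ω) (lam vs : ℝ≥0 → Ω → ℝ) (N : ℝ≥0 → Ω → ℕ) :
    Prop where
  lam_cont : ∀ ω, Continuous fun t => lam t ω
  poisson : IsDoublyStochasticPoisson μ (sigmaLV lam vs Set.univ) N lam

/-! ### Measurable schemes and conditional mean squared error -/

/-- A `𝒢`-measurable sampling scheme with `M` intervals on `[0, T]`. -/
structure IsSamplingScheme (μ : Measure Ω) (𝒢 : MeasurableSpace Ω) (T : ℝ≥0) (M : ℕ)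
    (τ : ℕ → Ω → ℝ≥0) : Prop where
  measurable : ∀ j ≤ M, Measurable[𝒢] (τ j)
  grid : ∀ᵐ ω ∂μ, IsGridAt T M τ ω

/-- The conditional mean squared error `E[(RV(τ) - IV(0,T))² | 𝒢]` in the model; it is the
conditional expectation of a nonnegative random variable, with values in `[0, ∞]`. -/
noncomputable def condMSE (μ : Measure Ω) (𝒢 : MeasurableSpace Ω) (P₀ : Ω → ℝ)
    (lam vs : ℝ≥0 → Ω → ℝ) (N : ℝ≥0 → Ω → ℕ) (B : ℝ≥0 → Ω → ℝ) (T : ℝ≥0) (M : ℕ)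
    (τ : ℕ → Ω → ℝ≥0) : Ω → ℝ≥0∞ :=
  condLExp 𝒢 μ fun ω =>
    ENNReal.ofReal ((RV (logPrice P₀ vs N B) M τ ω - IV lam vs 0 T ω) ^ 2)

end TTSV

/-! Given (λ, ς, N), the only randomness left is the noise B(i) - B(i-1) of the ticks, a sequence of
independent standard Gaussians. The returns over disjoint sampling intervals are then independent
centred Gaussians with variances v_j = rIV(τ_{j-1}, τ_j), so RV(τ) has mean Σ v_j = rIV(0,T) and
variance 2 Σ v_j². Squared bias plus variance is (rIV - IV)² + 2 Σ v_j² (`lintegral_sum_sq_blocks`,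
`condMSE_eq`). Only Σ v_j² depends on τ, and with V = Σ v_j fixed it equals V²/M + Σ (v_j - V/M)²
(`sum_sq_sub_div`): the minimum is attained exactly at equal v_j. Because ς > 0, rIV(0,·) and N grow
at the same times, so equal v_j determine the counts N(τ_j) and nothing more; an arrival time is
determined by its count.

Given only (λ, ς), the previous formula is averaged by the tower property. For a left-continuous h
known from (λ, ς), the sum of h over the ticks of the conditionally Poisson N has mean ∫ hλ and
variance ∫ h²λ (`setLIntegral_sq_tickSum`). With h = ς², (rIV - IV)² averages to Q = ∫ ς⁴λ; with h =
ς² cut to the j-th interval, v_j² averages to IV_j² plus the part of Q on that interval. The error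
is therefore 3Q + 2 Σ IV_j² (`condMSE_sigmaLV_eq`), and the same decomposition applies. Now IV(0,·)
is strictly increasing and continuous, so equal IV_j determine the times themselves.

The Poisson moment formula comes from a grid: increments are integrated out one at a time, last one
first, given the past of N; the grid is refined by dominated convergence on events where all
ingredients are bounded, and such events exhaust Ω. -/

namespace TTSV

/-! ### First hitting times -/

/-- The infimum of a nonempty set of times is attained if its complement is open to the right. -/
lemma csInf_mem_of_right {S : Set ℝ≥0} (hne : S.Nonempty)
    (h : ∀ t ∉ S, ∀ᶠ s in 𝓝[≥] t, s ∉ S) : sInf S ∈ S := by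
  by_contra hmem
  exact (((isGLB_csInf hne (OrderBot.bddBelow S)).frequently_mem hne).and_eventually
    (h _ hmem)).exists.elim fun _ hx => hx.2 hx.1

/-- The first time in `[0, T]` at which `φ` reaches the level `x`. -/
noncomputable def hitTime (φ : ℝ≥0 → ℝ) (T : ℝ≥0) (x : ℝ) : ℝ≥0 :=
  sInf {t | t ≤ T ∧ x ≤ φ t}

section HitTime

variable {φ : ℝ≥0 → ℝ} {T t : ℝ≥0} {x : ℝ}

lemma hitTime_mem (hrc : ∀ t, ContinuousWithinAt φ (Set.Ici t) t) (hx : x ≤ φ T) :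
    hitTime φ T x ≤ T ∧ x ≤ φ (hitTime φ T x) := by
  refine csInf_mem_of_right (S := {t | t ≤ T ∧ x ≤ φ t}) ⟨T, le_rfl, hx⟩ fun t ht => ?_
  by_cases htT : t ≤ T
  · have hlt : φ t < x := not_le.1 fun h => ht ⟨htT, h⟩
    filter_upwards [(hrc t).eventually (gt_mem_nhds hlt)] with s hs h
    exact absurd h.2 (not_le.2 hs)
  · filter_upwards [self_mem_nhdsWithin] with s hs h
    exact htT (le_trans hs h.1)

lemma hitTime_le_T : hitTime φ T x ≤ T := by
  by_cases h : ({t | t ≤ T ∧ x ≤ φ t} : Set ℝ≥0).Nonempty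
  · obtain ⟨t, ht⟩ := h
    exact (csInf_le (OrderBot.bddBelow _) ht).trans ht.1
  · rw [Set.not_nonempty_iff_eq_empty] at h
    simp [hitTime, h]

/-- A level that is never reached leaves an empty set of times, and `sInf ∅ = 0` in `ℝ≥0`. -/
lemma hitTime_eq_zero (hmono : Monotone φ) (hx : φ T < x) : hitTime φ T x = 0 := by
  have : {t | t ≤ T ∧ x ≤ φ t} = ∅ := by
    ext t
    simp only [Set.mem_ofPred_eq, Set.mem_empty_iff_false, iff_false, not_and, not_le]
    exact fun h => (hmono h).trans_lt hx
  simp [hitTime, this]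

lemma hitTime_le_iff (hmono : Monotone φ) (hrc : ∀ t, ContinuousWithinAt φ (Set.Ici t) t)
    (hx : x ≤ φ T) : hitTime φ T x ≤ t ↔ x ≤ φ (min t T) := by
  have h := hitTime_mem hrc hx
  refine ⟨fun ht => h.2.trans (hmono (le_min ht h.1)), fun ht => ?_⟩
  have hmem : min t T ∈ {t | t ≤ T ∧ x ≤ φ t} := ⟨min_le_right _ _, ht⟩
  exact (csInf_le (OrderBot.bddBelow _) hmem).trans (min_le_left _ _)

/-- The event that the hitting time is at most t is read off from Φ at two fixed times, both at most
T. The outcomes that never reach the level belong to it, because of the default value 0. -/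
lemma measurable_hitTime {α : Type*} [MeasurableSpace α] {Φ : ℝ≥0 → α → ℝ}
    (hmono : ∀ ω, Monotone fun t => Φ t ω)
    (hrc : ∀ ω t, ContinuousWithinAt (fun s => Φ s ω) (Set.Ici t) t)
    (hΦ : ∀ t ≤ T, Measurable (Φ t)) :
    Measurable fun ω => hitTime (fun t => Φ t ω) T x := by
  refine measurable_of_Iic fun t => ?_
  have : (fun ω => hitTime (fun t => Φ t ω) T x) ⁻¹' Set.Iic t
      = {ω | Φ T ω < x} ∪ {ω | x ≤ Φ (min t T) ω} := by
    ext ω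
    simp only [Set.mem_preimage, Set.mem_Iic, Set.mem_union, Set.mem_ofPred_eq]
    rcases lt_or_ge (Φ T ω) x with h | h
    · simp [h, hitTime_eq_zero (hmono ω) h]
    · simp [not_lt.2 h, hitTime_le_iff (hmono ω) (hrc ω) h]
  rw [this]
  exact (measurableSet_lt (hΦ T le_rfl) measurable_const).union
    (measurableSet_le measurable_const (hΦ _ (min_le_right _ _)))

end HitTime

/-! ### The grid of mesh `T / (n + 1)` -/

/-- The mesh of the `n`-th grid of `[0, T]`. -/
noncomputable def mesh (T : ℝ≥0) (n : ℕ) : ℝ≥0 := T / (n + 1)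

/-- The last point of the `n`-th grid that lies strictly before `t` (for `t > 0`). -/
noncomputable def gridBelow (T : ℝ≥0) (n : ℕ) (t : ℝ≥0) : ℝ≥0 :=
  ((⌈t / mesh T n⌉₊ - 1 : ℕ) : ℝ≥0) * mesh T n

section Grid

variable {T : ℝ≥0}

lemma mesh_pos (hT : 0 < T) (n : ℕ) : 0 < mesh T n := by
  unfold mesh; positivity

lemma tendsto_mesh : Tendsto (mesh T) atTop (𝓝 0) := by
  have h := (tendsto_const_div_atTop_nhds_zero_nat (T : ℝ)).comp (tendsto_add_atTop_nat 1)
  rw [← NNReal.tendsto_coe]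
  refine h.congr fun n => ?_
  simp [mesh]

lemma succ_mul_mesh (n : ℕ) : ((n + 1 : ℕ) : ℝ≥0) * mesh T n = T := by
  unfold mesh
  push_cast
  rw [mul_div_cancel₀]
  positivity

lemma gridBelow_le (hT : 0 < T) (n : ℕ) (t : ℝ≥0) : gridBelow T n t ≤ t := by
  have hδ := mesh_pos hT n
  rcases Nat.eq_zero_or_pos ⌈t / mesh T n⌉₊ with h | h
  · simp [gridBelow, h]
  · have h1 : ((⌈t / mesh T n⌉₊ - 1 : ℕ) : ℝ≥0) < t / mesh T n := by
      rw [← Nat.lt_ceil]; omega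
    exact ((lt_div_iff₀ hδ).1 h1).le

lemma le_gridBelow_add (hT : 0 < T) (n : ℕ) (t : ℝ≥0) : t ≤ gridBelow T n t + mesh T n := by
  have hδ := mesh_pos hT n
  have h1 : t / mesh T n ≤ ((⌈t / mesh T n⌉₊ - 1 : ℕ) : ℝ≥0) + 1 := by
    refine (Nat.le_ceil _).trans ?_
    have : ⌈t / mesh T n⌉₊ ≤ (⌈t / mesh T n⌉₊ - 1) + 1 := by omega
    exact_mod_cast this
  have h2 := (div_le_iff₀ hδ).1 h1
  rwa [add_mul, one_mul] at h2

lemma tendsto_gridBelow (hT : 0 < T) (t : ℝ≥0) :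
    Tendsto (fun n => gridBelow T n t) atTop (𝓝[≤] t) := by
  refine tendsto_nhdsWithin_iff.2 ⟨?_, .of_forall fun n => gridBelow_le hT n t⟩
  have h : Tendsto (fun n => t - mesh T n) atTop (𝓝 (t - 0)) :=
    tendsto_const_nhds.sub tendsto_mesh
  rw [tsub_zero] at h
  exact tendsto_of_tendsto_of_tendsto_of_le_of_le h tendsto_const_nhds
    (fun n => tsub_le_iff_right.2 (le_gridBelow_add hT n t)) fun n => gridBelow_le hT n t

/-- On the `k`-th cell of the grid, `gridBelow` is the left endpoint. -/
lemma gridBelow_eq (hT : 0 < T) {n k : ℕ} {t : ℝ≥0} (h1 : k * mesh T n < t)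
    (h2 : t ≤ (k + 1 : ℕ) * mesh T n) : gridBelow T n t = k * mesh T n := by
  have hδ := mesh_pos hT n
  have : ⌈t / mesh T n⌉₊ = k + 1 := by
    rw [Nat.ceil_eq_iff (by omega)]
    exact ⟨by rw [lt_div_iff₀ hδ]; simpa using h1, by rw [div_le_iff₀ hδ]; exact h2⟩
  simp [gridBelow, this]

/-! ### Joint measurability of left-continuous processes -/

/-- Evaluating at `gridBelow` uses countably many times, hence is jointly measurable;
left-continuity makes these evaluations converge, since the grid points approach from the left. -/
lemma measurable_leftCont {α : Type*} [MeasurableSpace α] (hT : 0 < T) {X : ℝ≥0 → α → ℝ}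
    (hX : ∀ s ≤ T, Measurable (X s))
    (hlc : ∀ ω t, ContinuousWithinAt (fun s => X s ω) (Set.Iic t) t) :
    Measurable fun p : α × ℝ≥0 => X (min p.2 T) p.1 := by
  refine measurable_of_tendsto_metrizable (f := fun n (p : α × ℝ≥0) =>
    X (gridBelow T n (min p.2 T)) p.1) (fun n => ?_) ?_
  · have h : Measurable fun q : ℕ × α => X (min (q.1 * mesh T n) T) q.2 :=
      measurable_from_prod_countable_right fun k => by
        exact hX (min (k * mesh T n) T) (min_le_right _ _)
    have h2 : Measurable fun p : α × ℝ≥0 => (⌈min p.2 T / mesh T n⌉₊ - 1, p.1) :=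
      ((measurable_of_countable fun k : ℕ => k - 1).comp (Nat.measurable_ceil.comp
        ((measurable_snd.min measurable_const).div_const _))).prodMk measurable_fst
    convert h.comp h2 using 2 with p
    exact congrArg (fun s => X s p.1)
      (min_eq_left ((gridBelow_le hT n (min p.2 T)).trans (min_le_right _ _))).symm
  · rw [tendsto_pi_nhds]
    intro p
    exact (hlc p.1 (min p.2 T)).tendsto.comp (tendsto_gridBelow hT _)

lemma measurable_integral_leftCont {α : Type*} [MeasurableSpace α] (hT : 0 < T)
    {X : ℝ≥0 → α → ℝ} (hX : ∀ s ≤ T, Measurable (X s))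
    (hlc : ∀ ω t, ContinuousWithinAt (fun s => X s ω) (Set.Iic t) t) :
    Measurable fun ω => ∫ r in (0 : ℝ)..T, X r.toNNReal ω := by
  have h1 : Measurable fun p : α × ℝ => X (min p.2.toNNReal T) p.1 :=
    (measurable_leftCont hT hX hlc).comp
      (measurable_fst.prodMk (measurable_real_toNNReal.comp measurable_snd))
  have h2 : (fun ω => ∫ r in (0 : ℝ)..T, X r.toNNReal ω)
      = fun ω => ∫ r in Set.Ioc (0 : ℝ) T, X (min r.toNNReal T) ω := by
    ext ω
    rw [intervalIntegral.integral_of_le T.coe_nonneg]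
    refine setIntegral_congr_fun measurableSet_Ioc fun r hr => ?_
    have : r.toNNReal ≤ T := Real.toNNReal_le_iff_le_coe.2 hr.2
    simp [min_eq_left this]
  rw [h2]
  exact (h1.stronglyMeasurable.integral_prod_right' (ν := volume.restrict _)).measurable

end Grid

lemma measurable_sum_Ioc {α : Type*} [MeasurableSpace α] {a b : α → ℕ} {g : ℕ → α → ℝ}
    (ha : Measurable a) (hb : Measurable b) (hg : ∀ i, Measurable (g i)) :
    Measurable fun x => ∑ i ∈ Finset.Ioc (a x) (b x), g i x := by
  have h : Measurable fun q : (ℕ × ℕ) × α => ∑ i ∈ Finset.Ioc q.1.1 q.1.2, g i q.2 :=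
    measurable_from_prod_countable_right fun k => by
      exact Finset.measurable_sum (Finset.Ioc k.1 k.2) fun i _ => hg i
  exact h.comp ((ha.prodMk hb).prodMk measurable_id)

/-! ### Freezing independent variables -/

/-- The joint law is the product of the marginal laws, so this is Tonelli's theorem. -/
lemma lintegral_freeze {Ω A E : Type*} [MeasurableSpace Ω] {mA : MeasurableSpace A}
    [MeasurableSpace E] {μ : Measure Ω} [IsProbabilityMeasure μ] {X : Ω → A} {Y : Ω → E}
    (hX : Measurable X) (hY : Measurable Y) (hXY : IndepFun X Y μ) {F : A × E → ℝ≥0∞}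
    (hF : Measurable F) :
    ∫⁻ ω, F (X ω, Y ω) ∂μ = ∫⁻ ω, ∫⁻ ω', F (X ω, Y ω') ∂μ ∂μ := by
  have h := (indepFun_iff_map_prod_eq_prod_map_map hX.aemeasurable hY.aemeasurable).1 hXY
  rw [← lintegral_map hF (hX.prodMk hY), h, lintegral_prod _ hF.aemeasurable,
    lintegral_map hF.lintegral_prod_right' hX]
  exact lintegral_congr fun ω => lintegral_map (hF.comp measurable_prodMk_left) hY

/-- Conditioning on `m` freezes the `m`-measurable ingredients of a function of an independent
variable. -/
lemma condLExp_freeze {Ω E : Type*} {m : MeasurableSpace Ω} [mΩ : MeasurableSpace Ω]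
    [mE : MeasurableSpace E] {μ : Measure Ω} [IsProbabilityMeasure μ] (hm : m ≤ mΩ) {Y : Ω → E}
    (hY : Measurable Y) (hind : Indep m (MeasurableSpace.comap Y mE) μ) {F : Ω × E → ℝ≥0∞}
    (hF : Measurable[m.prod mE] F) :
    condLExp m μ (fun ω => F (ω, Y ω)) =ᵐ[μ] fun ω => ∫⁻ ω', F (ω, Y ω') ∂μ := by
  -- The identity, viewed as a map into (Ω, m), is a random variable that generates m. This turns
  -- independence of σ-algebras into independence of variables.
  have hX : @Measurable Ω Ω mΩ m id := measurable_id'' hm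
  have hXY : @IndepFun Ω Ω E mΩ m mE id Y μ := by
    refine (@IndepFun_iff_Indep Ω Ω E mΩ m mE id Y μ).2 ?_
    rwa [MeasurableSpace.comap_id]
  refine (ae_eq_condLExp hm μ _ ?_ fun s hs => ?_).symm
  · have h1 : Measurable[m] fun ω => ∫⁻ y, F (ω, y) ∂(μ.map Y) :=
      @Measurable.lintegral_prod_right' Ω E m mE (μ.map Y) _ F hF
    convert h1 using 2 with ω
    have h2 : Measurable fun y => F (ω, y) :=
      @Measurable.comp E (Ω × E) _ mE (m.prod mE) _ F (fun y => (ω, y)) hF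
        (@measurable_prodMk_left Ω E m mE ω)
    exact (lintegral_map h2 hY).symm
  · have hG : Measurable[m.prod mE] fun p : Ω × E => s.indicator (fun _ => F p) p.1 := by
      have hs' : MeasurableSet[m.prod mE] (Prod.fst ⁻¹' s : Set (Ω × E)) :=
        @measurable_fst Ω E m mE _ hs
      exact Measurable.indicator hF hs'
    have h2 := @lintegral_freeze Ω Ω E mΩ m mE μ _ id Y hX hY hXY _ hG
    rw [← lintegral_indicator (hm s hs), ← lintegral_indicator (hm s hs)]
    simp only [id] at h2
    refine Eq.trans (lintegral_congr fun ω => ?_) (h2.symm.trans (lintegral_congr fun ω => ?_))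
    · by_cases h : ω ∈ s <;> simp [h]
    · by_cases h : ω ∈ s <;> simp [h]

/-! ### Paths of a counting process -/

section Paths

variable {Ω : Type*} {N : ℝ≥0 → Ω → ℕ} {ω : Ω} {i : ℕ} {s t T : ℝ≥0}

lemma IsCountingProcess.eventually_eq (hN : IsCountingProcess N) (ω : Ω) (t : ℝ≥0) :
    ∀ᶠ s in 𝓝[≥] t, N s ω = N t ω :=
  (hN.right_cont ω t).eventually (p := fun n => n = N t ω)
    (by rw [nhds_discrete]; exact eventually_pure.2 rfl)

lemma IsCountingProcess.rightCont_comp (hN : IsCountingProcess N) (f : ℕ → ℝ) (ω : Ω) (t : ℝ≥0) :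
    ContinuousWithinAt (fun s => f (N s ω)) (Set.Ici t) t :=
  tendsto_const_nhds.congr' ((hN.eventually_eq ω t).mono fun s hs => by
    simp only [hs])

lemma IsCountingProcess.le_apply_arrival (hN : IsCountingProcess N) (h : i ≤ N s ω) :
    i ≤ N (arrival N i ω) ω := by
  refine csInf_mem_of_right (S := {t | i ≤ N t ω}) ⟨s, h⟩ fun t ht => ?_
  filter_upwards [hN.eventually_eq ω t] with r hr hmem
  exact ht (hr ▸ hmem : i ≤ N t ω)

lemma arrival_le (h : i ≤ N t ω) : arrival N i ω ≤ t := csInf_le (OrderBot.bddBelow _) h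

lemma IsCountingProcess.arrival_le_iff (hN : IsCountingProcess N) (h : i ≤ N s ω) :
    arrival N i ω ≤ t ↔ i ≤ N t ω :=
  ⟨fun ht => (hN.le_apply_arrival h).trans (hN.mono ω ht), arrival_le⟩

/-- Unit jumps exclude an overshoot: a value above i at the i-th arrival time would force N ≥ i at
some earlier time, against the infimum. Earlier times exist because N starts at 0. -/
lemma IsCountingProcess.apply_arrival (hN : IsCountingProcess N) (h : i ≤ N s ω) :
    N (arrival N i ω) ω = i := by
  refine le_antisymm (not_lt.1 fun hlt => ?_) (hN.le_apply_arrival h)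
  have hpos : 0 < arrival N i ω := by
    rw [pos_iff_ne_zero]
    intro h0
    rw [h0, hN.zero] at hlt
    omega
  have : (𝓝[<] arrival N i ω).NeBot := nhdsLT_neBot_of_exists_lt ⟨0, hpos⟩
  obtain ⟨r, hr1, hr2⟩ :=
    ((hN.unit_jump ω (arrival N i ω)).and self_mem_nhdsWithin).exists
  exact absurd (arrival_le (show i ≤ N r ω by omega)) (not_le.2 hr2)

lemma IsCountingProcess.arrival_lt_iff (hN : IsCountingProcess N) (h : i ≤ N s ω) :
    t < arrival N i ω ↔ N t ω < i := by
  rw [← not_le, hN.arrival_le_iff h, not_le]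

/-- The noise `B(i) - B(i-1)` of the `i`-th tick. -/
def noise (B : ℝ≥0 → Ω → ℝ) (i : ℕ) (ω : Ω) : ℝ :=
  -- Written as an increment of B along the sequence i ↦ i - 1 with truncated subtraction, the form
  -- in which independence of increments is applied. For i = 0 it vanishes.
  B (((i + 1 : ℕ) - 1 : ℕ) : ℝ≥0) ω - B ((i - 1 : ℕ) : ℝ≥0) ω

lemma IsCountingProcess.tickShock_eq (hN : IsCountingProcess N) {B : ℝ≥0 → Ω → ℝ}
    (h : i ≤ N s ω) : tickShock N B i ω = noise B i ω := by
  rw [tickShock, hN.apply_arrival h, hN.apply_arrival ((Nat.sub_le i 1).trans h), noise,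
    Nat.add_sub_cancel]

/-- The `i`-th arrival time, seen from the information up to `T`. -/
noncomputable def tickTime (N : ℝ≥0 → Ω → ℕ) (T : ℝ≥0) (i : ℕ) (ω : Ω) : ℝ≥0 :=
  hitTime (fun t => (N t ω : ℝ)) T i

lemma tickTime_le : tickTime N T i ω ≤ T := hitTime_le_T

lemma IsCountingProcess.tickTime_le_iff (hN : IsCountingProcess N) (h : i ≤ N T ω) :
    tickTime N T i ω ≤ t ↔ i ≤ N (min t T) ω := by
  rw [tickTime, hitTime_le_iff (fun a b hab => by exact_mod_cast hN.mono ω hab)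
    (hN.rightCont_comp _ ω) (by exact_mod_cast h)]
  norm_cast

/-- `arrival` takes an infimum over all times, whereas `tickTime` reads N on [0, T] only and so is
measurable for the information up to T. For ticks up to T the two may be exchanged. -/
lemma IsCountingProcess.tickTime_eq (hN : IsCountingProcess N) (h : i ≤ N T ω) :
    tickTime N T i ω = arrival N i ω := by
  refine le_antisymm ?_ ?_
  · rw [hN.tickTime_le_iff h, min_eq_left (arrival_le h)]
    exact hN.le_apply_arrival h
  · have := (hN.tickTime_le_iff h).1 le_rfl
    rw [min_eq_left tickTime_le] at this
    exact arrival_le this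

lemma tickSum_congr {f g : ℕ → Ω → ℝ} (h : ∀ i ≤ N t ω, f i ω = g i ω) :
    tickSum N f s t ω = tickSum N g s t ω :=
  Finset.sum_congr rfl fun i hi => h i (Finset.mem_Ioc.1 hi).2

lemma IsCountingProcess.tickSum_add (hN : IsCountingProcess N) (f : ℕ → Ω → ℝ) (hst : s ≤ t) :
    tickSum N f 0 s ω + tickSum N f s t ω = tickSum N f 0 t ω :=
  Finset.sum_Ioc_consecutive _ (by rw [hN.zero]; exact Nat.zero_le _) (hN.mono ω hst)

variable {vs : ℝ≥0 → Ω → ℝ}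

lemma IsCountingProcess.logPrice_sub (hN : IsCountingProcess N) {P₀ : Ω → ℝ}
    {B : ℝ≥0 → Ω → ℝ} (hst : s ≤ t) (htT : t ≤ T) :
    logPrice P₀ vs N B t ω - logPrice P₀ vs N B s ω
      = ∑ i ∈ Finset.Ioc (N s ω) (N t ω), vs (tickTime N T i ω) ω * noise B i ω := by
  rw [logPrice, logPrice, ← hN.tickSum_add _ hst, add_sub_add_left_eq_sub, add_sub_cancel_left]
  refine tickSum_congr (g := fun i ω => vs (tickTime N T i ω) ω * noise B i ω) fun i hi => ?_
  rw [hN.tickShock_eq hi, hN.tickTime_eq (hi.trans (hN.mono ω htT))]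

lemma IsCountingProcess.rIV_eq (hN : IsCountingProcess N) (htT : t ≤ T) :
    rIV vs N s t ω = ∑ i ∈ Finset.Ioc (N s ω) (N t ω), vs (tickTime N T i ω) ω ^ 2 :=
  tickSum_congr (g := fun i ω => vs (tickTime N T i ω) ω ^ 2) fun i hi => by
    rw [hN.tickTime_eq (hi.trans (hN.mono ω htT))]

lemma IsCountingProcess.rIV_add (hN : IsCountingProcess N) (hst : s ≤ t) :
    rIV vs N 0 s ω + rIV vs N s t ω = rIV vs N 0 t ω := hN.tickSum_add _ hst

lemma rIV_nonneg : 0 ≤ rIV vs N s t ω := by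
  unfold rIV tickSum
  exact Finset.sum_nonneg fun _ _ => sq_nonneg _

lemma IsCountingProcess.rIV_mono (hN : IsCountingProcess N) (ω : Ω) :
    Monotone fun t => rIV vs N 0 t ω := fun s t hst => by
  have := hN.rIV_add (vs := vs) (ω := ω) hst
  have := rIV_nonneg (vs := vs) (N := N) (ω := ω) (s := s) (t := t)
  simp only
  linarith

lemma IsCountingProcess.rIV_rightCont (hN : IsCountingProcess N) (ω : Ω) (t : ℝ≥0) :
    ContinuousWithinAt (fun t => rIV vs N 0 t ω) (Set.Ici t) t :=
  hN.rightCont_comp (fun n => ∑ i ∈ Finset.Ioc (N 0 ω) n, vs (arrival N i ω) ω ^ 2) ω t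

lemma rIV_pos_iff (hvs : ∀ ω t, 0 < vs t ω) : 0 < rIV vs N s t ω ↔ N s ω < N t ω := by
  constructor
  · intro h
    by_contra hle
    rw [rIV, tickSum, Finset.Ioc_eq_empty hle, Finset.sum_empty] at h
    exact lt_irrefl _ h
  · intro h
    exact Finset.sum_pos (fun i _ => pow_pos (hvs ω _) 2) (Finset.nonempty_Ioc.2 h)

lemma IsCountingProcess.rIV_lt_iff (hN : IsCountingProcess N) (hvs : ∀ ω t, 0 < vs t ω) :
    rIV vs N 0 s ω < rIV vs N 0 t ω ↔ N s ω < N t ω := by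
  rcases le_total s t with hst | hst
  · rw [← rIV_pos_iff hvs (vs := vs), ← hN.rIV_add hst, lt_add_iff_pos_right]
  · exact iff_of_false (not_lt.2 (hN.rIV_mono ω hst)) (not_lt.2 (hN.mono ω hst))

/-- Every tick adds ς² > 0, so levels of rIV and tick counts carry the same information. This
converts equidistance into a statement about how the ticks are split. -/
lemma IsCountingProcess.rIV_eq_iff (hN : IsCountingProcess N) (hvs : ∀ ω t, 0 < vs t ω) :
    rIV vs N 0 s ω = rIV vs N 0 t ω ↔ N s ω = N t ω := by
  have h1 := hN.rIV_lt_iff hvs (s := s) (t := t) (ω := ω)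
  have h2 := hN.rIV_lt_iff hvs (s := t) (t := s) (ω := ω)
  constructor <;> intro h
  · have := h1.not.1 h.not_lt
    have := h2.not.1 h.not_gt
    omega
  · exact le_antisymm (not_lt.1 (h2.not.2 h.not_gt)) (not_lt.1 (h1.not.2 h.not_lt))

end Paths

/-! ### Measurability with respect to the information up to `T` -/

section Measurability

variable {Ω : Type*} {m : MeasurableSpace Ω} {N : ℝ≥0 → Ω → ℕ} {vs : ℝ≥0 → Ω → ℝ} {T : ℝ≥0}

lemma IsCountingProcess.measurable_tickTime (hN : IsCountingProcess N)
    (hNm : ∀ t ≤ T, Measurable (N t)) (i : ℕ) : Measurable (tickTime N T i) :=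
  measurable_hitTime (Φ := fun t ω => (N t ω : ℝ))
    (fun ω _ _ hab => Nat.cast_le.2 (hN.mono ω hab))
    (fun ω => hN.rightCont_comp _ ω) fun t ht => measurable_from_nat.comp (hNm t ht)

/-- N has reached k by the random time exactly when the k-th tick occurs up to T and not after that
time, so evaluation of N reduces to a comparison of two measurable times. -/
lemma IsCountingProcess.measurable_apply_time (hN : IsCountingProcess N)
    (hNm : ∀ t ≤ T, Measurable (N t)) {τ : Ω → ℝ≥0} (hτ : Measurable τ) :
    Measurable fun ω => N (min (τ ω) T) ω := by
  refine measurable_of_Ici fun k => ?_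
  have : (fun ω => N (min (τ ω) T) ω) ⁻¹' Set.Ici k
      = {ω | k ≤ N T ω} ∩ {ω | tickTime N T k ω ≤ τ ω} := by
    ext ω
    simp only [Set.mem_preimage, Set.mem_Ici, Set.mem_inter_iff, Set.mem_ofPred_eq]
    constructor
    · intro h
      have h' := h.trans (hN.mono ω (min_le_right _ _))
      exact ⟨h', (hN.tickTime_le_iff h').2 h⟩
    · exact fun h => (hN.tickTime_le_iff h.1).1 h.2
  rw [this]
  exact (measurableSet_le measurable_const (hNm T le_rfl)).inter
    (measurableSet_le (hN.measurable_tickTime hNm k) hτ)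

lemma measurable_apply_time_of_continuous {X : ℝ≥0 → Ω → ℝ} (hX : ∀ t ≤ T, Measurable (X t))
    (hc : ∀ ω, Continuous fun t => X t ω) {τ : Ω → ℝ≥0} (hτ : Measurable τ) :
    Measurable fun ω => X (min (τ ω) T) ω := by
  have h := measurable_uncurry_of_continuous_of_measurable (u := fun t ω => X (min t T) ω)
    (fun ω => (hc ω).comp (continuous_id.min continuous_const)) fun t => hX _ (min_le_right _ _)
  exact h.comp (hτ.prodMk measurable_id)

lemma IsCountingProcess.measurable_vs_tickTime (hN : IsCountingProcess N)
    (hNm : ∀ t ≤ T, Measurable (N t)) (hvm : ∀ t ≤ T, Measurable (vs t))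
    (hvc : ∀ ω, Continuous fun t => vs t ω) (i : ℕ) :
    Measurable fun ω => vs (tickTime N T i ω) ω := by
  have h := measurable_apply_time_of_continuous hvm hvc (hN.measurable_tickTime hNm i)
  convert h using 3
  rw [min_eq_left tickTime_le]

lemma IsCountingProcess.measurable_rIV (hN : IsCountingProcess N)
    (hNm : ∀ t ≤ T, Measurable (N t)) (hvm : ∀ t ≤ T, Measurable (vs t))
    (hvc : ∀ ω, Continuous fun t => vs t ω) {σ τ : Ω → ℝ≥0} (hσ : Measurable σ)
    (hτ : Measurable τ) :
    Measurable fun ω => rIV vs N (min (σ ω) T) (min (τ ω) T) ω := by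
  simp_rw [hN.rIV_eq (min_le_right _ T)]
  exact measurable_sum_Ioc (hN.measurable_apply_time hNm hσ) (hN.measurable_apply_time hNm hτ)
    fun i => (hN.measurable_vs_tickTime hNm hvm hvc i).pow_const 2

end Measurability

/-! ### Sums of squares of independent Gaussian variables -/

/-- The fourth moment is the fourth derivative at 0 of exp(vt²/2). Differentiating p(t) exp(vt²/2)
replaces p by p' + vtp; starting from p = 1, four rounds leave the constant term 3v². -/
lemma integral_pow_four_gaussianReal (v : ℝ≥0) :
    ∫ x, x ^ 4 ∂gaussianReal 0 v = 3 * (v : ℝ) ^ 2 := by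
  have h := iteratedDeriv_mgf_zero (X := id) (μ := gaussianReal 0 v)
    (by simp [integrableExpSet_id_gaussianReal]) 4
  rw [mgf_id_gaussianReal] at h
  have hd : ∀ p : ℝ → ℝ, ∀ q : ℝ → ℝ, (∀ t, HasDerivAt p (q t) t) →
      deriv (fun t => p t * Real.exp ((v : ℝ) * t ^ 2 / 2))
        = fun t => (q t + p t * (v * t)) * Real.exp ((v : ℝ) * t ^ 2 / 2) := by
    intro p q hp
    ext t
    have h1 : HasDerivAt (fun t : ℝ => (v : ℝ) * t ^ 2 / 2) (v * t) t :=
      (((hasDerivAt_pow 2 t).const_mul (v : ℝ)).div_const 2).congr_deriv (by push_cast; ring)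
    exact ((hp t).mul h1.exp).deriv.trans (by ring)
  have e0 : (fun t : ℝ => Real.exp (((0 : ℝ)) * t + (v : ℝ) * t ^ 2 / 2))
      = fun t => (fun _ => (1 : ℝ)) t * Real.exp ((v : ℝ) * t ^ 2 / 2) := by
    ext t; simp
  rw [e0, iteratedDeriv_succ', iteratedDeriv_succ', iteratedDeriv_succ', iteratedDeriv_one,
    hd (fun _ => 1) (fun _ => 0) (fun t => hasDerivAt_const _ _),
    hd _ (fun _ => v) (fun t => ?_), hd _ (fun t => 2 * v ^ 2 * t) (fun t => ?_),
    hd _ (fun t => 3 * v ^ 2 + 3 * v ^ 3 * t ^ 2) (fun t => ?_)] at h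
  · simpa using h.symm
  · refine HasDerivAt.congr_of_eventuallyEq (f := fun t => 3 * (v : ℝ) ^ 2 * t + v ^ 3 * t ^ 3)
      ?_ (.of_forall fun t => by simp only; ring)
    exact (((hasDerivAt_id t).const_mul (3 * (v : ℝ) ^ 2)).add
      ((hasDerivAt_pow 3 t).const_mul ((v : ℝ) ^ 3))).congr_deriv (by push_cast; ring)
  · refine HasDerivAt.congr_of_eventuallyEq (f := fun t => (v : ℝ) + v ^ 2 * t ^ 2)
      ?_ (.of_forall fun t => by simp only; ring)
    exact (((hasDerivAt_pow 2 t).const_mul ((v : ℝ) ^ 2)).const_add (v : ℝ)).congr_deriv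
      (by push_cast; ring)
  · refine HasDerivAt.congr_of_eventuallyEq (f := fun t => (v : ℝ) * t)
      ?_ (.of_forall fun t => by simp only; ring)
    exact ((hasDerivAt_id t).const_mul (v : ℝ)).congr_deriv (by ring)

section Blocks

variable {Ω : Type*} [MeasurableSpace Ω] {μ : Measure Ω} {ξ : ℕ → Ω → ℝ}

/-- Induction by adding an independent Gaussian. The law is required on `s` only, because the noise
with index 0 is degenerate. -/
lemma map_sum_gaussian [IsProbabilityMeasure μ] (hm : ∀ i, Measurable (ξ i))
    (hi : iIndepFun ξ μ) (a : ℕ → ℝ) (s : Finset ℕ)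
    (hl : ∀ i ∈ s, μ.map (ξ i) = gaussianReal 0 1) :
    μ.map (∑ i ∈ s, fun ω => a i * ξ i ω)
      = gaussianReal 0 (∑ i ∈ s, (a i ^ 2).toNNReal) := by
  induction s using Finset.induction_on with
  | empty =>
    simp only [Finset.sum_empty, gaussianReal_zero_var]
    exact (Measure.map_const μ (0 : ℝ)).trans (by simp)
  | insert i s his ih =>
    rw [Finset.sum_insert his, Finset.sum_insert his, add_comm, add_comm (a i ^ 2).toNNReal]
    have hind : iIndepFun (fun i ω => a i * ξ i ω) μ :=
      hi.comp (fun i x => a i * x) fun i => measurable_const_mul _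
    have h := gaussianReal_add_gaussianReal_of_indepFun
      (hind.indepFun_finsetSum_of_notMem (fun i => (hm i).const_mul _) his)
      (ih fun j hj => hl j (Finset.mem_insert_of_mem hj))
      (m₂ := 0) (v₂ := (a i ^ 2).toNNReal) ?_
    · simpa using h
    · have h1 := gaussianReal_map_const_mul (μ := 0) (v := 1) (a i)
      rw [← hl i (Finset.mem_insert_self _ _),
        Measure.map_map (measurable_const_mul _) (hm i)] at h1
      rw [Real.toNNReal_of_nonneg (sq_nonneg _)]
      simp only [mul_zero, mul_one] at h1
      exact h1

/-- Second moment of a centred quadratic functional built from disjoint blocks of independent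
standard Gaussian variables. -/
lemma lintegral_sum_sq_blocks [IsProbabilityMeasure μ] (hm : ∀ i, Measurable (ξ i))
    (hi : iIndepFun ξ μ) (hl : ∀ i, 1 ≤ i → μ.map (ξ i) = gaussianReal 0 1) (a : ℕ → ℝ)
    (k : ℕ → ℕ) (M : ℕ) (hk : ∀ j < M, k j ≤ k (j + 1)) (c : ℝ) :
    ∫⁻ ω, ENNReal.ofReal
        ((∑ j ∈ Finset.range M, (∑ i ∈ Finset.Ioc (k j) (k (j + 1)), a i * ξ i ω) ^ 2 - c) ^ 2) ∂μ
      = ENNReal.ofReal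
        ((∑ j ∈ Finset.range M, ∑ i ∈ Finset.Ioc (k j) (k (j + 1)), a i ^ 2 - c) ^ 2
          + 2 * ∑ j ∈ Finset.range M, (∑ i ∈ Finset.Ioc (k j) (k (j + 1)), a i ^ 2) ^ 2) := by
  set S : ℕ → Ω → ℝ := fun j ω => ∑ i ∈ Finset.Ioc (k j) (k (j + 1)), a i * ξ i ω with hS
  set v : ℕ → ℝ := fun j => ∑ i ∈ Finset.Ioc (k j) (k (j + 1)), a i ^ 2 with hv
  have hSm : ∀ j, Measurable (S j) := fun j =>
    Finset.measurable_sum _ fun i _ => (hm i).const_mul _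
  have hlaw : ∀ j, HasLaw (S j)
      (gaussianReal 0 (∑ i ∈ Finset.Ioc (k j) (k (j + 1)), (a i ^ 2).toNNReal)) μ := by
    intro j
    refine ⟨(hSm j).aemeasurable, ?_⟩
    -- Indices in a block exceed its left end, hence are at least 1, where the law is standard
    -- Gaussian.
    rw [← map_sum_gaussian hm hi a _ fun i hi => hl i (by
      have := (Finset.mem_Ioc.1 hi).1; omega)]
    congr 1
    ext ω
    simp [hS]
  have hvc : ∀ j, ((∑ i ∈ Finset.Ioc (k j) (k (j + 1)), (a i ^ 2).toNNReal : ℝ≥0) : ℝ)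
      = v j := fun j => by
    rw [NNReal.coe_sum]
    exact Finset.sum_congr rfl fun i _ => Real.coe_toNNReal _ (sq_nonneg _)
  have hmem4 : ∀ j, MemLp (S j) 4 μ := fun j => by
    have : HasGaussianLaw (S j) μ := (hlaw j).hasGaussianLaw
    exact this.memLp (by norm_num)
  have hint4 : ∀ j, Integrable (fun ω => S j ω ^ 4) μ := fun j => by
    have := (hmem4 j).integrable_norm_pow (p := 4) (by norm_num)
    refine this.congr (.of_forall fun ω => ?_)
    simp only [Real.norm_eq_abs]
    exact Even.pow_abs (by decide) _
  have hmem2 : ∀ j, MemLp (fun ω => S j ω ^ 2) 2 μ := fun j => by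
    rw [memLp_two_iff_integrable_sq ((hSm j).pow_const 2).aestronglyMeasurable]
    refine (hint4 j).congr (.of_forall fun ω => ?_)
    simp only
    ring
  have hE2 : ∀ j, ∫ ω, S j ω ^ 2 ∂μ = v j := fun j => by
    have h1 := (hlaw j).variance_eq
    have hz : ∫ ω, S j ω ∂μ = 0 := by
      rw [(hlaw j).integral_eq, integral_id_gaussianReal]
    rw [variance_eq_sub ((hmem4 j).mono_exponent (by norm_num)), hz, variance_id_gaussianReal,
      hvc] at h1
    simpa using h1
  have hE4 : ∀ j, ∫ ω, S j ω ^ 4 ∂μ = 3 * v j ^ 2 := fun j => by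
    rw [← hvc j, ← integral_pow_four_gaussianReal, ← (hlaw j).integral_comp
      (f := fun x => x ^ 4) (by fun_prop)]
    rfl
  -- The variance of a squared centred Gaussian is 3v² - v².
  have hvar : ∀ j, Var[fun ω => S j ω ^ 2; μ] = 2 * v j ^ 2 := fun j => by
    rw [variance_eq_sub (hmem2 j), hE2]
    have : ∫ ω, ((fun ω => S j ω ^ 2) ^ 2) ω ∂μ = ∫ ω, S j ω ^ 4 ∂μ :=
      integral_congr_ae (.of_forall fun ω => by simp only [Pi.pow_apply]; ring)
    rw [this, hE4]
    ring
  have hkm : ∀ i j, i ≤ j → j ≤ M → k i ≤ k j := by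
    intro i j hij
    induction j, hij using Nat.le_induction with
    | base => exact fun _ => le_rfl
    | succ n hn ih => exact fun h => (ih (by omega)).trans (hk n (by omega))
  have hpair : ∀ i j, i < j → j < M →
      IndepFun (fun ω => S i ω ^ 2) (fun ω => S j ω ^ 2) μ := by
    intro i j hij hjM
    -- Consecutive blocks are half-open with nondecreasing endpoints, so block i ends no later than
    -- block j begins; functions of disjoint families of independent variables are independent.
    have hdisj : Disjoint (Finset.Ioc (k i) (k (i + 1))) (Finset.Ioc (k j) (k (j + 1))) := by
      rw [Finset.disjoint_left]
      intro x hx hx'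
      have := hkm (i + 1) j hij hjM.le
      rw [Finset.mem_Ioc] at hx hx'
      omega
    have h := hi.indepFun_finset _ _ hdisj hm
    have key : ∀ j, Measurable fun u : Finset.Ioc (k j) (k (j + 1)) → ℝ =>
        (∑ i : Finset.Ioc (k j) (k (j + 1)), a i * u i) ^ 2 := fun j => by fun_prop
    convert h.comp (key i) (key j) using 1
    · ext ω
      simp only [hS, Function.comp]
      rw [← Finset.sum_coe_sort (Finset.Ioc (k i) (k (i + 1))) fun i => a i * ξ i ω]
    · ext ω
      simp only [hS, Function.comp]
      rw [← Finset.sum_coe_sort (Finset.Ioc (k j) (k (j + 1))) fun i => a i * ξ i ω]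
  have hpw : ((Finset.range M : Finset ℕ) : Set ℕ).Pairwise fun i j =>
      IndepFun (fun ω => S i ω ^ 2) (fun ω => S j ω ^ 2) μ := by
    intro i hi' j hj' hij
    simp only [Finset.coe_range, Set.mem_Iio] at hi' hj'
    rcases lt_or_gt_of_ne hij with h | h
    · exact hpair i j h hj'
    · exact (hpair j i h hi').symm
  have hvs := IndepFun.variance_sum (s := Finset.range M) (fun j _ => hmem2 j) hpw
  have hRmem : MemLp (∑ j ∈ Finset.range M, fun ω => S j ω ^ 2) 2 μ :=
    memLp_finsetSum' _ fun j _ => hmem2 j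
  set R := ∑ j ∈ Finset.range M, fun ω => S j ω ^ 2 with hR
  have hRint : Integrable R μ := hRmem.integrable (by norm_num)
  have hRE : ∫ ω, R ω ∂μ = ∑ j ∈ Finset.range M, v j := by
    simp only [hR, Finset.sum_apply]
    rw [integral_finsetSum _ fun j _ => (hmem2 j).integrable (by norm_num)]
    exact Finset.sum_congr rfl fun j _ => hE2 j
  rw [variance_eq_sub hRmem, hRE, Finset.sum_congr rfl fun j _ => hvar j, ← Finset.mul_sum] at hvs
  have hR2 : Integrable (fun ω => (R ω) ^ 2) μ := hRmem.integrable_sq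
  -- Squared bias plus variance, the variance being the sum computed in `hvs`.
  have hfin : ∫ ω, (R ω - c) ^ 2 ∂μ = (∑ j ∈ Finset.range M, v j - c) ^ 2
      + 2 * ∑ j ∈ Finset.range M, v j ^ 2 := by
    have e : (fun ω => (R ω - c) ^ 2) = fun ω => (R ω ^ 2 + (-2 * c) * R ω) + c ^ 2 := by
      ext ω; ring
    rw [e, integral_add (f := fun ω => R ω ^ 2 + (-2 * c) * R ω) (g := fun _ => c ^ 2)
      (hR2.add (hRint.const_mul _)) (integrable_const _),
      integral_add hR2 (hRint.const_mul _), integral_const_mul, hRE]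
    simp only [Pi.pow_apply] at hvs
    simp only [integral_const, probReal_univ, smul_eq_mul, one_mul]
    linarith
  rw [← hfin, ofReal_integral_eq_lintegral_ofReal]
  · refine lintegral_congr fun ω => ?_
    simp [hR, hS]
  · exact (hRmem.sub (memLp_const c)).integrable_sq
  · exact .of_forall fun ω => sq_nonneg _

end Blocks

/-! ### The noise of the ticks -/

section Noise

variable {Ω : Type*} [MeasurableSpace Ω] {μ : Measure Ω} {B : ℝ≥0 → Ω → ℝ}

lemma measurable_noise (hBm : ∀ t, Measurable (B t)) (i : ℕ) : Measurable (noise B i) :=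
  (hBm _).sub (hBm _)

/-- These are the increments of B along the monotone sequence 0, 0, 1, 2, …. -/
lemma iIndepFun_noise (hB : IsBrownianReal B μ) : iIndepFun (noise B) μ :=
  hB.toIsPreBrownianReal.hasIndepIncrements.nat (t := fun i : ℕ => ((i - 1 : ℕ) : ℝ≥0))
    fun i j hij => by
      have : i - 1 ≤ j - 1 := by omega
      exact Nat.cast_le.2 this

lemma map_noise (hB : IsBrownianReal B μ) {i : ℕ} (hi : 1 ≤ i) :
    μ.map (noise B i) = gaussianReal 0 1 := by
  have h := (hB.toIsPreBrownianReal.hasLaw_sub (((i + 1 : ℕ) - 1 : ℕ) : ℝ≥0)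
    ((i - 1 : ℕ) : ℝ≥0)).map_eq
  have hd : nndist ((((i + 1 : ℕ) - 1 : ℕ) : ℝ≥0) : ℝ) (((i - 1 : ℕ) : ℝ≥0) : ℝ) = 1 := by
    rw [← NNReal.coe_inj, coe_nndist, Real.dist_eq]
    simp only [NNReal.coe_natCast, Nat.add_sub_cancel, Nat.cast_sub hi, Nat.cast_one,
      sub_sub_cancel, abs_one, NNReal.coe_one]
  have h' : nndist ((((i + 1 : ℕ) - 1 : ℕ) : ℝ≥0)).1 (((i - 1 : ℕ) : ℝ≥0)).1 = 1 := hd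
  rw [h'] at h
  exact h

end Noise

/-! ### The σ-algebras generated by (λ, ς) and (λ, ς, N) -/

section SigmaAlgebras

variable {Ω : Type*}

lemma measurable_sigmaOf {E : Type*} [MeasurableSpace E] {X : ℝ≥0 → Ω → E} {S : Set ℝ≥0}
    {s : ℝ≥0} (hs : s ∈ S) : Measurable[sigmaOf X S] (X s) :=
  measurable_iff_comap_le.2 (le_iSup₂ (f := fun s (_ : s ∈ S) =>
    MeasurableSpace.comap (X s) inferInstance) s hs)

lemma sigmaOf_le {E : Type*} [MeasurableSpace E] {m : MeasurableSpace Ω} {X : ℝ≥0 → Ω → E}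
    {S : Set ℝ≥0} (h : ∀ s ∈ S, Measurable[m] (X s)) : sigmaOf X S ≤ m :=
  iSup₂_le fun s hs => measurable_iff_comap_le.1 (h s hs)

variable {lam vs : ℝ≥0 → Ω → ℝ} {N : ℝ≥0 → Ω → ℕ} {S S' : Set ℝ≥0} {s : ℝ≥0}

lemma measurable_lam_sigmaLV (hs : s ∈ S) : Measurable[sigmaLV lam vs S] (lam s) :=
  (measurable_sigmaOf hs).mono le_sup_left le_rfl

lemma measurable_vs_sigmaLV (hs : s ∈ S) : Measurable[sigmaLV lam vs S] (vs s) :=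
  (measurable_sigmaOf hs).mono le_sup_right le_rfl

lemma measurable_N_sigmaLVN (hs : s ∈ S) : Measurable[sigmaLVN lam vs N S] (N s) :=
  (measurable_sigmaOf hs).mono le_sup_right le_rfl

lemma sigmaLV_le_sigmaLVN : sigmaLV lam vs S ≤ sigmaLVN lam vs N S := le_sup_left

lemma sigmaLV_le {m : MeasurableSpace Ω} (hl : ∀ s ∈ S, Measurable[m] (lam s))
    (hv : ∀ s ∈ S, Measurable[m] (vs s)) : sigmaLV lam vs S ≤ m :=
  sup_le (sigmaOf_le hl) (sigmaOf_le hv)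

lemma sigmaLV_mono (h : S ⊆ S') : sigmaLV lam vs S ≤ sigmaLV lam vs S' :=
  sigmaLV_le (fun _ hs => measurable_lam_sigmaLV (h hs)) fun _ hs => measurable_vs_sigmaLV (h hs)

lemma sigmaLVN_mono (h : S ⊆ S') : sigmaLVN lam vs N S ≤ sigmaLVN lam vs N S' :=
  sup_le ((sigmaLV_mono h).trans sigmaLV_le_sigmaLVN)
    (sigmaOf_le fun _ hs => measurable_N_sigmaLVN (h hs))

end SigmaAlgebras

/-! ### Conditional mean squared error given (λ, ς, N) -/

section Model

variable {Ω : Type*} [mΩ : MeasurableSpace Ω] {μ : Measure Ω} {F : Filtration ℝ≥0 mΩ}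
  {lam vs : ℝ≥0 → Ω → ℝ} {N : ℝ≥0 → Ω → ℕ} {B : ℝ≥0 → Ω → ℝ} {P₀ : Ω → ℝ} {T : ℝ≥0} {M : ℕ}

lemma IsModel.measurable_lam (h : IsModel μ F lam vs N B) (t : ℝ≥0) : Measurable (lam t) :=
  ((h.lam_predictable.stronglyAdapted t).mono (F.le t)).measurable

lemma IsModel.measurable_vs (h : IsModel μ F lam vs N B) (t : ℝ≥0) : Measurable (vs t) :=
  ((h.vs_predictable.stronglyAdapted t).mono (F.le t)).measurable

lemma IsModel.measurable_N (h : IsModel μ F lam vs N B) (t : ℝ≥0) : Measurable (N t) :=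
  (h.N_adapted t).mono (F.le t) le_rfl

lemma IsModel.sigmaLVN_le (h : IsModel μ F lam vs N B) (S : Set ℝ≥0) : sigmaLVN lam vs N S ≤ mΩ :=
  sup_le (sigmaLV_le (fun s _ => h.measurable_lam s) fun s _ => h.measurable_vs s)
    (sigmaOf_le fun s _ => h.measurable_N s)

/-- `IV(0, T)` is determined by `(λ, ς)` on `[0, T]`. -/
lemma IsModel.measurable_IV (h : IsModel μ F lam vs N B) (hT : 0 < T) :
    Measurable[sigmaLV lam vs (Set.Iic T)] (IV lam vs 0 T) :=
  @measurable_integral_leftCont _ _ (sigmaLV lam vs (Set.Iic T)) hT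
    (fun r ω => vs r ω ^ 2 * lam r ω)
    (fun _ hs => Measurable.mul (Measurable.pow_const (measurable_vs_sigmaLV hs) 2)
      (measurable_lam_sigmaLV hs))
    fun ω t => ((h.vs_cont ω).continuousWithinAt.pow 2).mul (h.lam_left_cont ω t)

/-- The conditional mean squared error given `(λ, ς, N)`, for weakly increasing times. -/
theorem condMSE_eq [IsProbabilityMeasure μ] (h : IsModel μ F lam vs N B)
    (hind : IsIndependentNoise μ lam vs N B) (hT : 0 < T) {τ : ℕ → Ω → ℝ≥0}
    (hτ : ∀ j ≤ M, Measurable[sigmaLVN lam vs N (Set.Iic T)] (τ j))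
    (hgrid : ∀ᵐ ω ∂μ, τ M ω = T ∧ ∀ j < M, τ j ω ≤ τ (j + 1) ω) :
    condMSE μ (sigmaLVN lam vs N (Set.Iic T)) P₀ lam vs N B T M τ =ᵐ[μ] fun ω =>
      ENNReal.ofReal
        ((∑ j ∈ Finset.range M, rIV vs N (τ j ω) (τ (j + 1) ω) ω - IV lam vs 0 T ω) ^ 2
          + 2 * ∑ j ∈ Finset.range M, rIV vs N (τ j ω) (τ (j + 1) ω) ω ^ 2) := by
  have hN := h.counting
  have hGle : (sigmaLVN lam vs N (Set.Iic T)) ≤ mΩ := h.sigmaLVN_le _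
  have hNm : ∀ t ≤ T, Measurable[sigmaLVN lam vs N (Set.Iic T)] (N t) := fun t ht =>
    measurable_N_sigmaLVN ht
  have hvm : ∀ t ≤ T, Measurable[sigmaLVN lam vs N (Set.Iic T)] (vs t) := fun t ht =>
    (measurable_vs_sigmaLV ht).mono sigmaLV_le_sigmaLVN le_rfl
  have hle : ∀ᵐ ω ∂μ, ∀ j ≤ M, τ j ω ≤ T := by
    filter_upwards [hgrid] with ω hω j hj
    induction hj using Nat.decreasingInduction with
    | self => exact hω.1.le
    | of_succ k hk ih => exact (hω.2 k hk).trans ih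
  -- Truncation at T makes the block boundaries measurable for the information up to T; almost
  -- surely it changes nothing.
  set k : ℕ → Ω → ℕ := fun j ω => N (min (τ j ω) T) ω with hk
  have hkm : ∀ j ≤ M, Measurable[sigmaLVN lam vs N (Set.Iic T)] (k j) := fun j hj =>
    hN.measurable_apply_time hNm (hτ j hj)
  have hY : Measurable fun ω i => noise B i ω :=
    measurable_pi_lambda _ fun i => measurable_noise h.B_measurable i
  have hYind : Indep (sigmaLVN lam vs N (Set.Iic T))
      (MeasurableSpace.comap (fun ω i => noise B i ω) inferInstance) μ := by
    refine (indep_of_indep_of_le_left (indep_of_indep_of_le_right hind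
      (sigmaLVN_mono (Set.subset_univ _))) ?_).symm
    rw [← measurable_iff_comap_le]
    exact @measurable_pi_lambda Ω ℕ _ (sigmaOf B Set.univ) _ _ fun i =>
      Measurable.sub (measurable_sigmaOf (Set.mem_univ _)) (measurable_sigmaOf (Set.mem_univ _))
  -- The squared error with two separate arguments: the outcome, entering only through (λ, ς, N),
  -- and the noise sequence, which is independent of it.
  let Fz : Ω × (ℕ → ℝ) → ℝ≥0∞ := fun p => ENNReal.ofReal
    ((∑ j ∈ Finset.range M, (∑ i ∈ Finset.Ioc (k j p.1) (k (j + 1) p.1),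
      vs (tickTime N T i p.1) p.1 * p.2 i) ^ 2 - IV lam vs 0 T p.1) ^ 2)
  have hFz : Measurable[(sigmaLVN lam vs N (Set.Iic T)).prod inferInstance] Fz := by
    have hfst : @Measurable _ _ ((sigmaLVN lam vs N (Set.Iic T)).prod inferInstance)
        (sigmaLVN lam vs N (Set.Iic T)) (Prod.fst : Ω × (ℕ → ℝ) → Ω) :=
      @measurable_fst _ _ (sigmaLVN lam vs N (Set.Iic T)) _
    have hsnd : @Measurable _ _ ((sigmaLVN lam vs N (Set.Iic T)).prod inferInstance) _
        (Prod.snd : Ω × (ℕ → ℝ) → ℕ → ℝ) :=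
      @measurable_snd _ _ (sigmaLVN lam vs N (Set.Iic T)) _
    refine ENNReal.measurable_ofReal.comp (Measurable.pow_const (Measurable.sub
      (Finset.measurable_sum _ fun j hj => Measurable.pow_const ?_ 2) ?_) 2)
    · have hj' := Finset.mem_range.1 hj
      refine @measurable_sum_Ioc _ ((sigmaLVN lam vs N (Set.Iic T)).prod inferInstance) _ _ _
        ((hkm j hj'.le).comp hfst)
        ((hkm (j + 1) hj').comp hfst) fun i => ?_
      have h1 := hN.measurable_vs_tickTime hNm hvm h.vs_cont i
      exact Measurable.mul (h1.comp hfst) ((measurable_pi_apply i).comp hsnd)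
    · exact (((h.measurable_IV hT).mono sigmaLV_le_sigmaLVN le_rfl).comp hfst)
  have hcongr : condMSE μ (sigmaLVN lam vs N (Set.Iic T)) P₀ lam vs N B T M τ
      =ᵐ[μ] condLExp (sigmaLVN lam vs N (Set.Iic T)) μ fun ω => Fz (ω, fun i => noise B i ω) := by
    refine condLExp_congr_ae ?_
    filter_upwards [hgrid, hle] with ω hω hωT
    simp only [Fz, RV, hk]
    congr 3
    refine Finset.sum_congr rfl fun j hj => ?_
    have hj' := Finset.mem_range.1 hj
    rw [hN.logPrice_sub (hω.2 j hj') (hωT (j + 1) hj'), min_eq_left (hωT j hj'.le),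
      min_eq_left (hωT (j + 1) hj')]
  refine hcongr.trans ((condLExp_freeze hGle hY hYind hFz).trans ?_)
  filter_upwards [hgrid, hle] with ω hω hωT
  have hmono : ∀ j < M, k j ω ≤ k (j + 1) ω := fun j hj =>
    hN.mono ω (min_le_min_right _ (hω.2 j hj))
  have hrIV : ∀ j ∈ Finset.range M, ∑ i ∈ Finset.Ioc (k j ω) (k (j + 1) ω),
      vs (tickTime N T i ω) ω ^ 2 = rIV vs N (τ j ω) (τ (j + 1) ω) ω := fun j hj => by
    have hj' := Finset.mem_range.1 hj
    rw [hN.rIV_eq (hωT (j + 1) hj')]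
    simp only [hk, min_eq_left (hωT j hj'.le), min_eq_left (hωT (j + 1) hj')]
  -- At a frozen outcome the tick volatilities are fixed coefficients and the tick counts at the
  -- sampling times are fixed block boundaries.
  have hmain := lintegral_sum_sq_blocks (fun i => measurable_noise h.B_measurable i)
    (iIndepFun_noise h.B_brownian) (fun i hi => map_noise h.B_brownian hi)
    (fun i => vs (tickTime N T i ω) ω) (fun j => k j ω) M hmono (IV lam vs 0 T ω)
  simp only [Fz]
  have hrIV2 : ∀ j ∈ Finset.range M, (∑ i ∈ Finset.Ioc (k j ω) (k (j + 1) ω),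
      vs (tickTime N T i ω) ω ^ 2) ^ 2 = rIV vs N (τ j ω) (τ (j + 1) ω) ω ^ 2 := fun j hj => by
    rw [hrIV j hj]
  rw [hmain, Finset.sum_congr rfl hrIV, Finset.sum_congr rfl hrIV2]

end Model

/-! ### Equidistant splitting -/

/-- Deviations from the mean sum to zero, so the cross term drops out. Both the lower bound and its
equality case are read off from the nonnegative remainder. -/
lemma sum_sq_sub_div (v : ℕ → ℝ) {M : ℕ} (hM : 0 < M) :
    ∑ j ∈ Finset.range M, v j ^ 2 = (∑ j ∈ Finset.range M, v j) ^ 2 / M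
      + ∑ j ∈ Finset.range M, (v j - (∑ j ∈ Finset.range M, v j) / M) ^ 2 := by
  have hM' : (M : ℝ) ≠ 0 := by positivity
  set V := ∑ j ∈ Finset.range M, v j with hV
  have : ∀ j, (v j - V / M) ^ 2 = v j ^ 2 - 2 * (V / M) * v j + (V / M) ^ 2 := fun j => by ring
  simp_rw [this]
  rw [Finset.sum_add_distrib, Finset.sum_sub_distrib, ← Finset.mul_sum, ← hV]
  simp only [Finset.sum_const, Finset.card_range, nsmul_eq_mul]
  field_simp
  ring

lemma sq_sum_div_le (v : ℕ → ℝ) {M : ℕ} (hM : 0 < M) :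
    (∑ j ∈ Finset.range M, v j) ^ 2 / M ≤ ∑ j ∈ Finset.range M, v j ^ 2 := by
  rw [sum_sq_sub_div v hM]
  exact le_add_of_nonneg_right (Finset.sum_nonneg fun _ _ => sq_nonneg _)

lemma sum_sq_eq_iff (v : ℕ → ℝ) {M : ℕ} (hM : 0 < M) :
    ∑ j ∈ Finset.range M, v j ^ 2 = (∑ j ∈ Finset.range M, v j) ^ 2 / M ↔
      ∀ j < M, v j = (∑ j ∈ Finset.range M, v j) / M := by
  rw [sum_sq_sub_div v hM, add_eq_left, Finset.sum_eq_zero_iff_of_nonneg fun _ _ => sq_nonneg _]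
  simp [sub_eq_zero]

/-- The cumulative form constrains each sampling time separately, which is what identifies the times
or their tick counts. -/
lemma increments_eq_iff {f : ℕ → ℝ} {M : ℕ} {c : ℝ} (h0 : f 0 = 0) :
    (∀ j < M, f (j + 1) - f j = c) ↔ ∀ j ≤ M, f j = j * c := by
  constructor
  · intro h j hj
    induction j with
    | zero => simp [h0]
    | succ j ih =>
      have := h j (by omega)
      have := ih (by omega)
      push_cast
      linarith
  · intro h j hj
    rw [h j hj.le, h (j + 1) hj]
    push_cast
    ring

/-! ### Sampling times of an accumulated intensity -/

section SamplingTimes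

variable {Ω : Type*} {Φ : ℝ≥0 → Ω → ℝ} {T : ℝ≥0} {M j : ℕ} {ω : Ω}

lemma samplingTimes_self : samplingTimes Φ T M M ω = T := if_pos rfl

lemma samplingTimes_of_ne (hj : j ≠ M) :
    samplingTimes Φ T M j ω = hitTime (fun t => Φ t ω) T (j * T / M) := if_neg hj

lemma samplingTimes_le : samplingTimes Φ T M j ω ≤ T := by
  by_cases h : j = M
  · exact h ▸ samplingTimes_self.le
  · rw [samplingTimes_of_ne h]
    exact hitTime_le_T

lemma samplingTimes_zero (hM : 0 < M) (h0 : 0 ≤ Φ 0 ω) : samplingTimes Φ T M 0 ω = 0 := by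
  rw [samplingTimes_of_ne hM.ne]
  have hmem : (0 : ℝ≥0) ∈ {t | t ≤ T ∧ ((0 : ℕ) : ℝ) * T / M ≤ Φ t ω} :=
    ⟨T.2, by simpa using h0⟩
  exact le_antisymm (csInf_le (OrderBot.bddBelow _) hmem) zero_le

lemma level_le (hj : j ≤ M) (h : Φ T ω = T) : (j : ℝ) * T / M ≤ Φ T ω := by
  rw [h]
  rcases Nat.eq_zero_or_pos M with rfl | hM
  · simp
  · rw [div_le_iff₀ (by positivity), mul_comm]
    have : (j : ℝ) ≤ M := by exact_mod_cast hj
    exact mul_le_mul_of_nonneg_left this T.2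

lemma le_apply_samplingTimes (hrc : ∀ t, ContinuousWithinAt (fun s => Φ s ω) (Set.Ici t) t)
    (hj : j ≤ M) (h : Φ T ω = T) : (j : ℝ) * T / M ≤ Φ (samplingTimes Φ T M j ω) ω := by
  by_cases hjM : j = M
  · subst hjM
    rw [samplingTimes_self]
    exact level_le le_rfl h
  · rw [samplingTimes_of_ne hjM]
    exact (hitTime_mem hrc (level_le hj h)).2

lemma samplingTimes_le_of_le {t : ℝ≥0} (hjM : j ≠ M) (ht : t ≤ T)
    (h : (j : ℝ) * T / M ≤ Φ t ω) : samplingTimes Φ T M j ω ≤ t := by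
  rw [samplingTimes_of_ne hjM]
  have hmem : t ∈ {t | t ≤ T ∧ (j : ℝ) * T / M ≤ Φ t ω} := ⟨ht, h⟩
  exact csInf_le (OrderBot.bddBelow _) hmem

/-- At the next sampling time the lower level has been reached as well. The inequality may be an
equality, since one jump of Φ can cross several levels. -/
lemma samplingTimes_le_succ (hrc : ∀ t, ContinuousWithinAt (fun s => Φ s ω) (Set.Ici t) t)
    (hj : j < M) (h : Φ T ω = T) :
    samplingTimes Φ T M j ω ≤ samplingTimes Φ T M (j + 1) ω := by
  refine samplingTimes_le_of_le hj.ne samplingTimes_le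
    (le_trans ?_ (le_apply_samplingTimes hrc hj h))
  push_cast
  gcongr
  simp

lemma measurable_samplingTimes [MeasurableSpace Ω] (hmono : ∀ ω, Monotone fun t => Φ t ω)
    (hrc : ∀ ω t, ContinuousWithinAt (fun s => Φ s ω) (Set.Ici t) t)
    (hΦ : ∀ t ≤ T, Measurable (Φ t)) (j : ℕ) : Measurable (samplingTimes Φ T M j) := by
  by_cases h : j = M
  · have : samplingTimes Φ T M j = fun _ => T := by
      ext ω
      rw [h, samplingTimes_self]
    rw [this]
    exact measurable_const
  · have : samplingTimes Φ T M j = fun ω => hitTime (fun t => Φ t ω) T (j * T / M) := by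
      ext ω
      rw [samplingTimes_of_ne h]
    rw [this]
    exact measurable_hitTime hmono hrc hΦ

end SamplingTimes

/-! ### Realized business time sampling -/

section RBTS

variable {Ω : Type*} {vs : ℝ≥0 → Ω → ℝ} {N : ℝ≥0 → Ω → ℕ} {T : ℝ≥0} {M j : ℕ} {ω : Ω}
  {τ : ℕ → Ω → ℝ≥0}

lemma IsCountingProcess.sum_rIV (hN : IsCountingProcess N) (h0 : τ 0 ω = 0)
    (hmono : ∀ j < M, τ j ω ≤ τ (j + 1) ω) :
    ∑ j ∈ Finset.range M, rIV vs N (τ j ω) (τ (j + 1) ω) ω = rIV vs N 0 (τ M ω) ω := by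
  have h : ∀ j ∈ Finset.range M, rIV vs N (τ j ω) (τ (j + 1) ω) ω
      = rIV vs N 0 (τ (j + 1) ω) ω - rIV vs N 0 (τ j ω) ω := fun j hj => by
    rw [← hN.rIV_add (hmono j (Finset.mem_range.1 hj)), add_sub_cancel_left]
  rw [Finset.sum_congr rfl h, Finset.sum_range_sub fun j => rIV vs N 0 (τ j ω) ω, h0]
  simp [rIV, tickSum]

lemma IsCountingProcess.isEquidistantRIV_iff (hN : IsCountingProcess N) (h0 : τ 0 ω = 0)
    (hmono : ∀ j < M, τ j ω ≤ τ (j + 1) ω) :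
    IsEquidistantRIV vs N T M τ ω ↔
      ∀ j ≤ M, rIV vs N 0 (τ j ω) ω = j * (rIV vs N 0 T ω / M) := by
  rw [← increments_eq_iff (f := fun j => rIV vs N 0 (τ j ω) ω) (by simp [h0, rIV, tickSum])]
  refine forall₂_congr fun j hj => ?_
  rw [← hN.rIV_add (hmono j hj), add_sub_cancel_left]

lemma IsCountingProcess.rBTS_rightCont (hN : IsCountingProcess N) (ω : Ω) (t : ℝ≥0) :
    ContinuousWithinAt (fun t => T * rIV vs N 0 t ω / rIV vs N 0 T ω) (Set.Ici t) t :=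
  ((hN.rIV_rightCont ω t).const_mul _).div_const _

lemma IsCountingProcess.rBTS_mono (hN : IsCountingProcess N) (ω : Ω) :
    Monotone fun t => T * rIV vs N 0 t ω / rIV vs N 0 T ω := fun _ _ hst =>
  div_le_div_of_nonneg_right (mul_le_mul_of_nonneg_left (hN.rIV_mono ω hst) T.2) rIV_nonneg

lemma rBTS_zero (hM : 0 < M) : rBTS vs N T M 0 ω = 0 :=
  samplingTimes_zero hM (by simp [rIV, tickSum])

lemma rBTS_self : rBTS vs N T M M ω = T := samplingTimes_self

/-- Without ticks the quotient is 0 by convention, no level with j ≥ 1 is reached, and all times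
with j < M are 0. So realized business times are weakly ordered at every outcome, and the error
formula for weakly increasing times covers them even where they are no strict grid. -/
lemma IsCountingProcess.rBTS_le_succ (hN : IsCountingProcess N) (hT : 0 < T) (hj : j < M) :
    rBTS vs N T M j ω ≤ rBTS vs N T M (j + 1) ω := by
  rcases (rIV_nonneg (vs := vs) (N := N) (s := 0) (t := T) (ω := ω)).eq_or_lt with h | h
  · rcases Nat.eq_zero_or_pos j with rfl | hj0
    · rw [rBTS_zero hj]
      exact zero_le
    · rw [rBTS, samplingTimes_of_ne hj.ne, hitTime_eq_zero (hN.rBTS_mono ω)]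
      · exact zero_le
      · rw [← h, div_zero]
        have := hj0.trans hj
        have hT' : (0 : ℝ) < T := hT
        positivity
  · exact samplingTimes_le_succ (hN.rBTS_rightCont ω) hj (by field_simp)

/-- Each interval carries a positive share of rIV, hence contains a tick, hence is nondegenerate. -/
lemma IsCountingProcess.isGridAt_rBTS (hN : IsCountingProcess N) (hvs : ∀ ω t, 0 < vs t ω)
    (hM : 0 < M) (hpos : 0 < rIV vs N 0 T ω)
    (heq : IsEquidistantRIV vs N T M (rBTS vs N T M) ω) : IsGridAt T M (rBTS vs N T M) ω := by
  refine ⟨rBTS_zero hM, rBTS_self, fun j hj => ?_⟩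
  have h : 0 < rIV vs N (rBTS vs N T M j ω) (rBTS vs N T M (j + 1) ω) ω := by
    rw [heq j hj]
    positivity
  exact not_le.1 fun hle => absurd ((rIV_pos_iff hvs).1 h) (not_lt.2 (hN.mono ω hle))

lemma IsCountingProcess.measurable_rBTS {m : MeasurableSpace Ω} (hN : IsCountingProcess N)
    (hNm : ∀ t ≤ T, Measurable (N t)) (hvm : ∀ t ≤ T, Measurable (vs t))
    (hvc : ∀ ω, Continuous fun t => vs t ω) (j : ℕ) : Measurable (rBTS vs N T M j) := by
  have h : ∀ t ≤ T, Measurable fun ω => rIV vs N 0 t ω := fun t ht => by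
    have := hN.measurable_rIV hNm hvm hvc (σ := fun _ => 0) (τ := fun _ => t) measurable_const
      measurable_const
    simpa [min_eq_left ht] using this
  exact measurable_samplingTimes hN.rBTS_mono hN.rBTS_rightCont
    (fun t ht => ((h t ht).const_mul _).div (h T le_rfl)) j

/-- Where `rIV(0, T) > 0`, the interior times of realized business time sampling are arrival
times. -/
lemma IsCountingProcess.arrival_rBTS (hN : IsCountingProcess N) (hpos : 0 < rIV vs N 0 T ω)
    (hj : j < M) : arrival N (N (rBTS vs N T M j ω) ω) ω = rBTS vs N T M j ω := by
  set r := rBTS vs N T M j ω with hr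
  have hle : arrival N (N r ω) ω ≤ r := arrival_le le_rfl
  have hrT : r ≤ T := samplingTimes_le
  -- The last tick at or before r has the same rIV as r, so the level is already reached there; r is
  -- the first such time.
  refine le_antisymm hle (samplingTimes_le_of_le hj.ne (hle.trans hrT) ?_)
  have hN' : N (arrival N (N r ω) ω) ω = N r ω := hN.apply_arrival le_rfl
  have hlev := le_apply_samplingTimes (Φ := fun t ω => T * rIV vs N 0 t ω / rIV vs N 0 T ω)
    (hN.rBTS_rightCont (T := T) (vs := vs) ω) hj.le (by field_simp)
  have : rIV vs N 0 (arrival N (N r ω) ω) ω = rIV vs N 0 r ω := by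
    simp only [rIV, tickSum, hN']
  rw [this]
  exact hlev

end RBTS

/-! ### Sampling given `(λ, ς, N)` -/

section PartA

variable {Ω : Type*} [mΩ : MeasurableSpace Ω] {μ : Measure Ω} {F : Filtration ℝ≥0 mΩ}
  {lam vs : ℝ≥0 → Ω → ℝ} {N : ℝ≥0 → Ω → ℕ} {B : ℝ≥0 → Ω → ℝ} {P₀ : Ω → ℝ} {T : ℝ≥0} {M : ℕ}

/-- Both real quantities are nonnegative, so `ENNReal.ofReal` is injective on them and the
comparison reduces to S against V²/M. -/
lemma ofReal_bound_le_iff {x V S c : ℝ} (hx : x = (V - c) ^ 2 + 2 * S) (hM : 0 < M)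
    (hS : V ^ 2 / M ≤ S) :
    ENNReal.ofReal ((V - c) ^ 2 + 2 * V ^ 2 / M) ≤ ENNReal.ofReal x ∧
      (ENNReal.ofReal x = ENNReal.ofReal ((V - c) ^ 2 + 2 * V ^ 2 / M) ↔ S = V ^ 2 / M) := by
  have h0 : 0 ≤ V ^ 2 / M := by positivity
  have h1 : 2 * V ^ 2 / M = 2 * (V ^ 2 / M) := by ring
  refine ⟨ENNReal.ofReal_le_ofReal (by rw [hx, h1]; linarith), ?_⟩
  rw [ENNReal.ofReal_eq_ofReal_iff (by rw [hx]; nlinarith [sq_nonneg (V - c)])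
    (by rw [h1]; nlinarith [sq_nonneg (V - c)]), hx, h1]
  constructor <;> intro h <;> linarith

/-- The lower bound on the conditional mean squared error given `(λ, ς, N)`. -/
theorem condMSE_bound [IsProbabilityMeasure μ] (h : IsModel μ F lam vs N B)
    (hind : IsIndependentNoise μ lam vs N B) (hT : 0 < T) (hM : 0 < M) {τ : ℕ → Ω → ℝ≥0}
    (hτ : ∀ j ≤ M, Measurable[sigmaLVN lam vs N (Set.Iic T)] (τ j))
    (hgrid : ∀ᵐ ω ∂μ, τ 0 ω = 0 ∧ τ M ω = T ∧ ∀ j < M, τ j ω ≤ τ (j + 1) ω) :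
    ∀ᵐ ω ∂μ,
      ENNReal.ofReal ((rIV vs N 0 T ω - IV lam vs 0 T ω) ^ 2 + 2 * rIV vs N 0 T ω ^ 2 / M) ≤
          condMSE μ (sigmaLVN lam vs N (Set.Iic T)) P₀ lam vs N B T M τ ω ∧
        (condMSE μ (sigmaLVN lam vs N (Set.Iic T)) P₀ lam vs N B T M τ ω =
            ENNReal.ofReal ((rIV vs N 0 T ω - IV lam vs 0 T ω) ^ 2
              + 2 * rIV vs N 0 T ω ^ 2 / M) ↔
          IsEquidistantRIV vs N T M τ ω) := by
  filter_upwards [condMSE_eq (P₀ := P₀) h hind hT hτ (hgrid.mono fun ω hω => hω.2), hgrid]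
    with ω hω hg
  have hsum := h.counting.sum_rIV (vs := vs) hg.1 hg.2.2
  rw [hg.2.1] at hsum
  have hle := sq_sum_div_le (fun j => rIV vs N (τ j ω) (τ (j + 1) ω) ω) hM
  have hiff := sum_sq_eq_iff (fun j => rIV vs N (τ j ω) (τ (j + 1) ω) ω) hM
  rw [hsum] at hω hle hiff
  rw [hω]
  have := ofReal_bound_le_iff (M := M) (c := IV lam vs 0 T ω) rfl hM hle
  exact ⟨this.1, this.2.trans hiff⟩

/-- Where realized business times are equidistant they attain the lower bound, so a tie means that τ
attains it too. Both then have the same rIV up to each sampling time, which is the same as equal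
tick counts. -/
theorem sampling_given_arrivals [IsProbabilityMeasure μ] (h : IsModel μ F lam vs N B)
    (hind : IsIndependentNoise μ lam vs N B) (hT : 0 < T) (hM : 0 < M) {τ : ℕ → Ω → ℝ≥0}
    (hτ : IsSamplingScheme μ (sigmaLVN lam vs N (Set.Iic T)) T M τ) :
    ∀ᵐ ω ∂μ, 0 < rIV vs N 0 T ω → IsEquidistantRIV vs N T M (rBTS vs N T M) ω →
      condMSE μ (sigmaLVN lam vs N (Set.Iic T)) P₀ lam vs N B T M (rBTS vs N T M) ω ≤
          condMSE μ (sigmaLVN lam vs N (Set.Iic T)) P₀ lam vs N B T M τ ω ∧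
        (condMSE μ (sigmaLVN lam vs N (Set.Iic T)) P₀ lam vs N B T M τ ω =
            condMSE μ (sigmaLVN lam vs N (Set.Iic T)) P₀ lam vs N B T M (rBTS vs N T M) ω ↔
          ∀ j ≤ M, N (τ j ω) ω = N (rBTS vs N T M j ω) ω) ∧
        ((∀ j, 0 < j → j < M → IsTick N T (τ j ω) ω) →
          (condMSE μ (sigmaLVN lam vs N (Set.Iic T)) P₀ lam vs N B T M τ ω =
              condMSE μ (sigmaLVN lam vs N (Set.Iic T)) P₀ lam vs N B T M (rBTS vs N T M) ω ↔
            ∀ j ≤ M, τ j ω = rBTS vs N T M j ω)) := by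
  have hN := h.counting
  have hr := condMSE_bound (P₀ := P₀) h hind hT hM (τ := rBTS vs N T M)
    (fun j _ => hN.measurable_rBTS
      (fun t ht => measurable_N_sigmaLVN ht)
      (fun t ht => (measurable_vs_sigmaLV ht).mono sigmaLV_le_sigmaLVN le_rfl) h.vs_cont j)
    (.of_forall fun ω => ⟨rBTS_zero hM, rBTS_self, fun j hj => hN.rBTS_le_succ hT hj⟩)
  filter_upwards [hr, hτ.grid, condMSE_bound (P₀ := P₀) h hind hT hM hτ.measurable
    (hτ.grid.mono fun ω hω => ⟨hω.1, hω.2.1, fun j hj => (hω.2.2 j hj).le⟩)]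
    with ω hr hg hb hpos heq
  rw [hr.2.2 heq]
  have key : IsEquidistantRIV vs N T M τ ω ↔
      ∀ j ≤ M, N (τ j ω) ω = N (rBTS vs N T M j ω) ω := by
    rw [hN.isEquidistantRIV_iff hg.1 fun j hj => (hg.2.2 j hj).le]
    have hre := (hN.isEquidistantRIV_iff (rBTS_zero hM) fun j hj => hN.rBTS_le_succ hT hj).1 heq
    refine forall₂_congr fun j hj => ?_
    rw [← hre j hj, hN.rIV_eq_iff h.vs_pos]
  refine ⟨hb.1, hb.2.trans key, fun htick => (hb.2.trans key).trans ?_⟩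
  constructor
  · intro hNeq j hj
    rcases Nat.eq_zero_or_pos j with rfl | hj0
    · rw [hg.1, rBTS_zero hM]
    rcases hj.eq_or_lt with rfl | hjM
    · rw [hg.2.1, rBTS_self]
    obtain ⟨i, -, hiT, hi⟩ := htick j hj0 hjM
    have h1 : N (τ j ω) ω = i := by rw [hi, hN.apply_arrival hiT]
    -- Both times are arrival times, so each is recovered from its common tick count.
    rw [← hN.arrival_rBTS hpos hjM, ← hNeq j hj, h1, hi]
  · exact fun hτeq j hj => by rw [hτeq j hj]

end PartA

/-! ### Second moments of the Poisson distribution -/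

/-- For K Poisson with mean L, x + aK has mean x + aL and variance a²L. The moments of K come from
cancelling k against k! and shifting the exponential series by one. -/
lemma hasSum_poisson_sq (x a L : ℝ) :
    HasSum (fun k : ℕ => (x + a * k) ^ 2 * (Real.exp (-L) * L ^ k / (k.factorial : ℝ)))
      ((x + a * L) ^ 2 + a ^ 2 * L) := by
  have h0 : HasSum (fun k : ℕ => L ^ k / (k.factorial : ℝ)) (Real.exp L) := by
    rw [Real.exp_eq_exp_ℝ]
    exact NormedSpace.expSeries_div_hasSum_exp L
  have h1 : HasSum (fun k : ℕ => (k : ℝ) * (L ^ k / (k.factorial : ℝ))) (L * Real.exp L) := by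
    rw [← hasSum_nat_add_iff' 1]
    have e : (fun k : ℕ => ((k + 1 : ℕ) : ℝ) * (L ^ (k + 1) / ((k + 1).factorial : ℝ)))
        = fun k : ℕ => L * (L ^ k / (k.factorial : ℝ)) := by
      funext k
      rw [Nat.factorial_succ]
      push_cast
      field_simp
      exact pow_succ' L k
    rw [e]
    simp only [Finset.range_one, Finset.sum_singleton, Nat.cast_zero, zero_mul, sub_zero]
    exact h0.mul_left L
  have h2 : HasSum (fun k : ℕ => (k : ℝ) ^ 2 * (L ^ k / (k.factorial : ℝ)))
      (L * (L * Real.exp L + Real.exp L)) := by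
    rw [← hasSum_nat_add_iff' 1]
    have e : (fun k : ℕ => ((k + 1 : ℕ) : ℝ) ^ 2 * (L ^ (k + 1) / ((k + 1).factorial : ℝ)))
        = fun k : ℕ => L * ((k : ℝ) * (L ^ k / (k.factorial : ℝ)) + L ^ k / (k.factorial : ℝ)) := by
      funext k
      rw [Nat.factorial_succ]
      push_cast
      field_simp
      exact pow_succ' L k
    rw [e]
    simp only [Finset.range_one, Finset.sum_singleton, Nat.cast_zero, ne_eq, OfNat.ofNat_ne_zero,
      not_false_eq_true, zero_pow, zero_mul, sub_zero]
    exact (h1.add h0).mul_left L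
  have h3 := (((h0.mul_left (x ^ 2)).add (h1.mul_left (2 * x * a))).add
    (h2.mul_left (a ^ 2))).mul_left (Real.exp (-L))
  have he : Real.exp (-L) * Real.exp L = 1 := by rw [← Real.exp_add]; simp
  have hv : (x + a * L) ^ 2 + a ^ 2 * L = Real.exp (-L) * (x ^ 2 * Real.exp L
      + 2 * x * a * (L * Real.exp L) + a ^ 2 * (L * (L * Real.exp L + Real.exp L))) := by
    linear_combination (-(x + a * L) ^ 2 - a ^ 2 * L) * he
  rw [hv]
  refine h3.congr_fun fun k => ?_
  ring

/-- The weight of `k` under the Poisson distribution with mean `L`. -/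
noncomputable def poissonWeight (L : ℝ) (k : ℕ) : ℝ :=
  Real.exp (-L) * L ^ k / (k.factorial : ℝ)

lemma poissonWeight_nonneg {L : ℝ} (hL : 0 ≤ L) (k : ℕ) : 0 ≤ poissonWeight L k := by
  unfold poissonWeight
  positivity

lemma tsum_poisson_sq (x a : ℝ) {L : ℝ} (hL : 0 ≤ L) :
    ∑' k : ℕ, ENNReal.ofReal ((x + a * k) ^ 2) * ENNReal.ofReal (poissonWeight L k)
      = ENNReal.ofReal ((x + a * L) ^ 2 + a ^ 2 * L) := by
  have h : HasSum (fun k : ℕ => (x + a * k) ^ 2 * poissonWeight L k) _ := hasSum_poisson_sq x a L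
  rw [← h.tsum_eq, ENNReal.ofReal_tsum_of_nonneg
    (fun k => mul_nonneg (sq_nonneg _) (poissonWeight_nonneg hL k)) h.summable]
  exact tsum_congr fun k => (ENNReal.ofReal_mul (sq_nonneg _)).symm

/-! ### Conditionally Poisson increments -/

section Increments

variable {Ω : Type*} {G : MeasurableSpace Ω} [mΩ : MeasurableSpace Ω] {μ : Measure Ω}
  [IsProbabilityMeasure μ] {N : ℝ≥0 → Ω → ℕ} {lam : ℝ≥0 → Ω → ℝ} {s t T : ℝ≥0}

/-- The accumulated intensity `∫_s^t λ(r) dr`. -/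
noncomputable def cumIntensity {Ω : Type*} (lam : ℝ≥0 → Ω → ℝ) (s t : ℝ≥0) (ω : Ω) : ℝ :=
  ∫ r in (s : ℝ)..(t : ℝ), lam r.toNNReal ω

lemma cumIntensity_nonneg {Ω : Type*} {lam : ℝ≥0 → Ω → ℝ} (hpos : ∀ ω t, 0 < lam t ω)
    (hst : s ≤ t) (ω : Ω) : 0 ≤ cumIntensity lam s t ω :=
  intervalIntegral.integral_nonneg hst fun _ _ => (hpos ω _).le

/-- The Poisson weight is the conditional probability of the event given G and the past of N. It can
therefore replace the indicator of the event under integrals of functions known at time s. -/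
lemma setIntegral_poisson (hG : G ≤ mΩ) (hNm : ∀ t, Measurable (N t))
    (hP : IsDoublyStochasticPoisson μ G N lam) (hst : s ≤ t)
    (hpos : ∀ ω t, 0 < lam t ω) (k : ℕ) {g : Ω → ℝ≥0∞}
    (hg : Measurable[G ⊔ sigmaOf N (Set.Iic s)] g) :
    ∫⁻ ω in {ω | N t ω = N s ω + k}, g ω ∂μ
      = ∫⁻ ω, g ω * ENNReal.ofReal (poissonWeight (cumIntensity lam s t ω) k) ∂μ := by
  have hH : G ⊔ sigmaOf N (Set.Iic s) ≤ mΩ := sup_le hG (sigmaOf_le fun s _ => hNm s)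
  set E : Set Ω := {ω | N t ω = N s ω + k} with hE
  have hEm : MeasurableSet E := measurableSet_eq_fun (hNm t) ((hNm s).add_const k)
  set p : Ω → ℝ := fun ω => poissonWeight (cumIntensity lam s t ω) k with hp
  have hce : condExp (G ⊔ sigmaOf N (Set.Iic s)) μ (E.indicator fun _ => (1 : ℝ)) =ᵐ[μ] p :=
    hP s t hst k
  have hp0 : ∀ ω, 0 ≤ p ω := fun ω => poissonWeight_nonneg (cumIntensity_nonneg hpos hst ω) k
  -- Integrability and a.e. measurability of the weight are inherited from the conditional
  -- expectation with which it agrees.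
  have hpi : Integrable p μ := integrable_condExp.congr hce
  have hpm : AEMeasurable (fun ω => ENNReal.ofReal (p ω)) μ := hpi.aemeasurable.ennreal_ofReal
  have hEi : Integrable (E.indicator fun _ => (1 : ℝ)) μ :=
    (integrable_const (1 : ℝ)).indicator hEm
  have hset : ∀ A, MeasurableSet[G ⊔ sigmaOf N (Set.Iic s)] A →
      μ.restrict E A = μ.withDensity (fun ω => ENNReal.ofReal (p ω)) A := by
    intro A hA
    have hA' := hH A hA
    rw [withDensity_apply _ hA', Measure.restrict_apply hA',
      ← ofReal_integral_eq_lintegral_ofReal hpi.integrableOn (.of_forall hp0),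
      ← setIntegral_congr_ae hA' (hce.mono fun ω h _ => h), setIntegral_condExp hH hEi hA,
      setIntegral_indicator hEm]
    simp
  -- The two measures agree on sets of the smaller σ-algebra, so their trims coincide and give the
  -- same integral to every function measurable there.
  have htrim : (μ.restrict E).trim hH = (μ.withDensity fun ω => ENNReal.ofReal (p ω)).trim hH := by
    refine @Measure.ext _ (G ⊔ sigmaOf N (Set.Iic s)) _ _ fun A hA => ?_
    rw [trim_measurableSet_eq hH hA, trim_measurableSet_eq hH hA, hset A hA]
  rw [← lintegral_trim hH hg, htrim, lintegral_trim hH hg,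
    lintegral_withDensity_eq_lintegral_mul₀ hpm (hg.mono hH le_rfl).aemeasurable]
  exact lintegral_congr fun ω => mul_comm _ _

/-- X and a are known at time s. Splitting by the value k of the increment and summing against the
Poisson weights leaves the Poisson second moment at frozen X and a. -/
lemma setLIntegral_sq_add_increment (hG : G ≤ mΩ) (hN : IsCountingProcess N)
    (hNm : ∀ t, Measurable (N t)) (hP : IsDoublyStochasticPoisson μ G N lam) (hst : s ≤ t)
    (hpos : ∀ ω t, 0 < lam t ω) (hLm : Measurable (cumIntensity lam s t)) {X a : Ω → ℝ} {A : Set Ω}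
    (hX : Measurable[G ⊔ sigmaOf N (Set.Iic s)] X)
    (ha : Measurable[G ⊔ sigmaOf N (Set.Iic s)] a)
    (hA : MeasurableSet[G ⊔ sigmaOf N (Set.Iic s)] A) :
    ∫⁻ ω in A, ENNReal.ofReal ((X ω + a ω * ((N t ω : ℝ) - N s ω)) ^ 2) ∂μ
      = ∫⁻ ω in A, ENNReal.ofReal ((X ω + a ω * cumIntensity lam s t ω) ^ 2
          + a ω ^ 2 * cumIntensity lam s t ω) ∂μ := by
  have hH : G ⊔ sigmaOf N (Set.Iic s) ≤ mΩ := sup_le hG (sigmaOf_le fun s _ => hNm s)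
  have hE : ∀ k, MeasurableSet {ω | N t ω = N s ω + k} := fun k =>
    measurableSet_eq_fun (hNm t) ((hNm s).add_const k)
  set g : ℕ → Ω → ℝ≥0∞ := fun k => A.indicator fun ω => ENNReal.ofReal ((X ω + a ω * k) ^ 2)
    with hg
  have hgm : ∀ k, Measurable[G ⊔ sigmaOf N (Set.Iic s)] (g k) := fun k =>
    Measurable.indicator (ENNReal.measurable_ofReal.comp
      (Measurable.pow_const (Measurable.add hX (Measurable.mul_const ha _)) 2)) hA
  have hwm : ∀ k, Measurable fun ω => ENNReal.ofReal (poissonWeight (cumIntensity lam s t ω) k) :=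
    fun k => by
      unfold poissonWeight
      fun_prop
  calc ∫⁻ ω in A, ENNReal.ofReal ((X ω + a ω * ((N t ω : ℝ) - N s ω)) ^ 2) ∂μ
      = ∫⁻ ω, ∑' k, ({ω | N t ω = N s ω + k} : Set Ω).indicator (g k) ω ∂μ := by
        rw [← lintegral_indicator (hH A hA)]
        refine lintegral_congr fun ω => ?_
        have hle : N s ω ≤ N t ω := hN.mono ω hst
        -- Exactly one k contributes, namely the actual increment.
        rw [tsum_eq_single (N t ω - N s ω)]
        · have hmem : ω ∈ {ω' | N t ω' = N s ω' + (N t ω - N s ω)} := by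
            show N t ω = N s ω + (N t ω - N s ω)
            omega
          rw [Set.indicator_of_mem hmem, hg]
          by_cases hωA : ω ∈ A
          · simp [hωA, Nat.cast_sub hle]
          · simp [hωA]
        · intro k hk
          refine Set.indicator_of_notMem (fun hmem => hk ?_) _
          have : N t ω = N s ω + k := hmem
          omega
    _ = ∑' k, ∫⁻ ω in {ω | N t ω = N s ω + k}, g k ω ∂μ := by
        rw [lintegral_tsum fun k => (((hgm k).mono hH le_rfl).indicator (hE k)).aemeasurable]
        exact tsum_congr fun k => lintegral_indicator (hE k) _
    _ = ∑' k, ∫⁻ ω, g k ω * ENNReal.ofReal (poissonWeight (cumIntensity lam s t ω) k) ∂μ :=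
        tsum_congr fun k => setIntegral_poisson hG hNm hP hst hpos k (hgm k)
    _ = ∫⁻ ω, ∑' k, g k ω * ENNReal.ofReal (poissonWeight (cumIntensity lam s t ω) k) ∂μ :=
        (lintegral_tsum fun k => (((hgm k).mono hH le_rfl).mul (hwm k)).aemeasurable).symm
    _ = _ := by
        rw [← lintegral_indicator (hH A hA)]
        refine lintegral_congr fun ω => ?_
        by_cases hωA : ω ∈ A
        · simp only [hg, Set.indicator_of_mem hωA]
          exact tsum_poisson_sq _ _ (cumIntensity_nonneg hpos hst ω)
        · simp [hg, hωA]

/-- Second moment of a centred sum of weighted increments, given `G`. -/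
lemma setLIntegral_sq_sum_increments (hG : G ≤ mΩ) (hN : IsCountingProcess N)
    (hNm : ∀ t, Measurable (N t)) (hP : IsDoublyStochasticPoisson μ G N lam)
    (hpos : ∀ ω t, 0 < lam t ω) {u : ℕ → ℝ≥0} (hu : Monotone u) {n : ℕ}
    (hLm : ∀ k < n, Measurable[G] (cumIntensity lam (u k) (u (k + 1)))) {a : ℕ → Ω → ℝ}
    (ha : ∀ k < n, Measurable[G] (a k)) {c : Ω → ℝ} (hc : Measurable[G] c) {A : Set Ω}
    (hA : MeasurableSet[G] A) :
    ∫⁻ ω in A, ENNReal.ofReal ((∑ k ∈ Finset.range n,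
        a k ω * ((N (u (k + 1)) ω : ℝ) - N (u k) ω) - c ω) ^ 2) ∂μ
      = ∫⁻ ω in A, ENNReal.ofReal
        ((∑ k ∈ Finset.range n, a k ω * cumIntensity lam (u k) (u (k + 1)) ω - c ω) ^ 2
          + ∑ k ∈ Finset.range n, a k ω ^ 2 * cumIntensity lam (u k) (u (k + 1)) ω) ∂μ := by
  -- The last increment is integrated out first, given the past of N. Its mean is known from G and
  -- is absorbed into the centring, hence the generalization over `c`; its variance splits off as a
  -- separate term.
  induction n generalizing c with
  | zero => simp
  | succ n ih =>
    have hGH : G ≤ G ⊔ sigmaOf N (Set.Iic (u n)) := le_sup_left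
    have hNH : ∀ k ≤ n, Measurable[G ⊔ sigmaOf N (Set.Iic (u n))] fun ω => (N (u k) ω : ℝ) :=
      fun k hk => measurable_from_nat.comp
        ((measurable_sigmaOf (hu hk)).mono le_sup_right le_rfl)
    have hXm : Measurable[G ⊔ sigmaOf N (Set.Iic (u n))] fun ω => ∑ k ∈ Finset.range n,
        a k ω * ((N (u (k + 1)) ω : ℝ) - N (u k) ω) - c ω := by
      refine Measurable.sub (Finset.measurable_sum _ fun k hk => ?_) (hc.mono hGH le_rfl)
      have hk := Finset.mem_range.1 hk
      exact Measurable.mul ((ha k (by omega)).mono hGH le_rfl)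
        (Measurable.sub (hNH (k + 1) hk) (hNH k hk.le))
    have han := ha n (by omega)
    have hLn := hLm n (by omega)
    have h1 := setLIntegral_sq_add_increment hG hN hNm hP (hu (Nat.le_succ n)) hpos
      (hLn.mono hG le_rfl) hXm (han.mono hGH le_rfl) (hGH A hA)
    have hc' : Measurable[G] fun ω => c ω - a n ω * cumIntensity lam (u n) (u (n + 1)) ω :=
      Measurable.sub hc (Measurable.mul han hLn)
    have h2 := ih (fun k hk => hLm k (by omega)) (fun k hk => ha k (by omega)) hc'
    have hw : Measurable fun ω =>
        ENNReal.ofReal (a n ω ^ 2 * cumIntensity lam (u n) (u (n + 1)) ω) :=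
      (((han.mono hG le_rfl).pow_const 2).mul (hLn.mono hG le_rfl)).ennreal_ofReal
    have hnn : ∀ k ω, 0 ≤ a k ω ^ 2 * cumIntensity lam (u k) (u (k + 1)) ω := fun k ω =>
      mul_nonneg (sq_nonneg _) (cumIntensity_nonneg hpos (hu (Nat.le_succ k)) ω)
    calc _ = ∫⁻ ω in A, ENNReal.ofReal ((∑ k ∈ Finset.range n,
          a k ω * ((N (u (k + 1)) ω : ℝ) - N (u k) ω) - c ω
            + a n ω * ((N (u (n + 1)) ω : ℝ) - N (u n) ω)) ^ 2) ∂μ := by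
          refine lintegral_congr fun ω => ?_
          rw [Finset.sum_range_succ]
          congr 2
          ring
      _ = _ := h1
      _ = ∫⁻ ω in A, (ENNReal.ofReal ((∑ k ∈ Finset.range n,
          a k ω * ((N (u (k + 1)) ω : ℝ) - N (u k) ω)
            - (c ω - a n ω * cumIntensity lam (u n) (u (n + 1)) ω)) ^ 2)
          + ENNReal.ofReal (a n ω ^ 2 * cumIntensity lam (u n) (u (n + 1)) ω)) ∂μ := by
          refine lintegral_congr fun ω => ?_
          rw [ENNReal.ofReal_add (sq_nonneg _) (hnn n ω)]
          congr 3
          ring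
      _ = ∫⁻ ω in A, (ENNReal.ofReal ((∑ k ∈ Finset.range n,
            a k ω * cumIntensity lam (u k) (u (k + 1)) ω
              - (c ω - a n ω * cumIntensity lam (u n) (u (n + 1)) ω)) ^ 2
            + ∑ k ∈ Finset.range n, a k ω ^ 2 * cumIntensity lam (u k) (u (k + 1)) ω)
          + ENNReal.ofReal (a n ω ^ 2 * cumIntensity lam (u n) (u (n + 1)) ω)) ∂μ := by
          rw [lintegral_add_right _ hw, lintegral_add_right _ hw, h2]
      _ = _ := by
          refine lintegral_congr fun ω => ?_
          rw [← ENNReal.ofReal_add (add_nonneg (sq_nonneg _)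
            (Finset.sum_nonneg fun k _ => hnn k ω)) (hnn n ω), Finset.sum_range_succ,
            Finset.sum_range_succ]
          congr 1
          ring

end Increments

/-! ### Riemann sums along the grid -/

section RiemannSums

variable {T : ℝ≥0} {h : ℝ≥0 → ℝ}

lemma sum_Ioc_range (g : ℕ → ℝ) {f : ℕ → ℕ} (hf : Monotone f) (m : ℕ) :
    ∑ k ∈ Finset.range m, ∑ i ∈ Finset.Ioc (f k) (f (k + 1)), g i
      = ∑ i ∈ Finset.Ioc (f 0) (f m), g i := by
  induction m with
  | zero => simp
  | succ m ih =>
    rw [Finset.sum_range_succ, ih, Finset.sum_Ioc_consecutive _ (hf (Nat.zero_le m))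
      (hf (Nat.le_succ m))]

lemma monotone_grid (T : ℝ≥0) (n : ℕ) : Monotone fun k : ℕ => (k : ℝ≥0) * mesh T n :=
  fun _ _ hij => mul_le_mul_of_nonneg_right (Nat.cast_le.2 hij) zero_le

lemma grid_le {n k : ℕ} (hk : k ≤ n + 1) : (k : ℝ≥0) * mesh T n ≤ T :=
  (monotone_grid T n hk).trans_eq (succ_mul_mesh n)

/-- All ticks in a cell share the left endpoint as `gridBelow`, so the Riemann–Stieltjes sum against
N is a sum over ticks with the arrival times moved to the grid. -/
lemma IsCountingProcess.sum_grid {Ω : Type*} {N : ℝ≥0 → Ω → ℕ} (hN : IsCountingProcess N)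
    (hT : 0 < T) (n : ℕ) (ω : Ω) :
    ∑ k ∈ Finset.range (n + 1), h (k * mesh T n) *
        ((N ((k + 1 : ℕ) * mesh T n) ω : ℝ) - N (k * mesh T n) ω)
      = ∑ i ∈ Finset.Ioc 0 (N T ω), h (gridBelow T n (arrival N i ω)) := by
  have hf : Monotone fun k : ℕ => N (k * mesh T n) ω := fun i j hij =>
    hN.mono ω (monotone_grid T n hij)
  have hsum := sum_Ioc_range (fun i => h (gridBelow T n (arrival N i ω))) hf (n + 1)
  simp only [Nat.cast_zero, zero_mul, hN.zero, succ_mul_mesh] at hsum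
  rw [← hsum]
  refine Finset.sum_congr rfl fun k _ => ?_
  have hcell : ∀ i ∈ Finset.Ioc (N (k * mesh T n) ω) (N ((k + 1 : ℕ) * mesh T n) ω),
      h (gridBelow T n (arrival N i ω)) = h (k * mesh T n) := fun i hi => by
    obtain ⟨h1, h2⟩ := Finset.mem_Ioc.1 hi
    rw [gridBelow_eq hT ((hN.arrival_lt_iff h2).2 h1) (arrival_le h2)]
  rw [Finset.sum_congr rfl hcell, Finset.sum_const, Nat.card_Ioc, nsmul_eq_mul, mul_comm,
    Nat.cast_sub (hf (Nat.le_succ k))]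

lemma tendsto_sum_gridBelow (hT : 0 < T) (hlc : ∀ t, ContinuousWithinAt h (Set.Iic t) t)
    (s : Finset ℕ) (x : ℕ → ℝ≥0) :
    Tendsto (fun n => ∑ i ∈ s, h (gridBelow T n (x i))) atTop (𝓝 (∑ i ∈ s, h (x i))) :=
  tendsto_finsetSum _ fun i _ => (hlc (x i)).tendsto.comp (tendsto_gridBelow hT _)

lemma measurable_comp_gridBelow (T : ℝ≥0) (n : ℕ) (h : ℝ≥0 → ℝ) :
    Measurable fun t => h (gridBelow T n t) :=
  (measurable_from_nat (f := fun k : ℕ => h (((k - 1 : ℕ) : ℝ≥0) * mesh T n))).comp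
    (Nat.measurable_ceil.comp (measurable_id.div_const _))

/-- The counterpart of `sum_grid` for the compensator: on a cell, open at its left end, h ∘
`gridBelow` is constant. -/
lemma integral_grid (hT : 0 < T) {l : ℝ → ℝ} (hl : Continuous l) (n : ℕ) :
    ∑ k ∈ Finset.range (n + 1), h (k * mesh T n) *
        ∫ r in ((k * mesh T n : ℝ≥0) : ℝ)..(((k + 1 : ℕ) * mesh T n : ℝ≥0) : ℝ), l r
      = ∫ r in (0 : ℝ)..T, h (gridBelow T n r.toNNReal) * l r := by
  have hle : ∀ k : ℕ, ((k * mesh T n : ℝ≥0) : ℝ) ≤ (((k + 1 : ℕ) * mesh T n : ℝ≥0) : ℝ) :=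
    fun k => monotone_grid T n (Nat.le_succ k)
  have hcell : ∀ k : ℕ, ∀ r ∈ Set.uIoc ((k * mesh T n : ℝ≥0) : ℝ)
      (((k + 1 : ℕ) * mesh T n : ℝ≥0) : ℝ),
      h (gridBelow T n r.toNNReal) * l r = h (k * mesh T n) * l r := fun k r hr => by
    rw [Set.uIoc_of_le (hle k)] at hr
    rw [gridBelow_eq hT (k := k)]
    · exact Real.lt_toNNReal_iff_coe_lt.2 hr.1
    · exact Real.toNNReal_le_iff_le_coe.2 hr.2
  have hint := intervalIntegral.sum_integral_adjacent_intervals (μ := volume)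
    (f := fun r => h (gridBelow T n r.toNNReal) * l r)
    (a := fun k : ℕ => ((k * mesh T n : ℝ≥0) : ℝ)) (n := n + 1) fun k _ =>
      ((hl.const_mul (h (k * mesh T n))).intervalIntegrable _ _).congr
        fun r hr => (hcell k r hr).symm
  rw [succ_mul_mesh] at hint
  simp only [Nat.cast_zero, zero_mul, NNReal.coe_zero] at hint
  rw [← hint]
  refine Finset.sum_congr rfl fun k _ => ?_
  rw [← intervalIntegral.integral_const_mul]
  refine intervalIntegral.integral_congr_ae (.of_forall fun r hr => (hcell k r hr).symm)

lemma tendsto_integral_gridBelow (hT : 0 < T) (hlc : ∀ t, ContinuousWithinAt h (Set.Iic t) t)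
    {l : ℝ → ℝ} (hl : Continuous l) {K : ℝ} (hK : ∀ s ≤ T, |h s| ≤ K) :
    Tendsto (fun n => ∫ r in (0 : ℝ)..T, h (gridBelow T n r.toNNReal) * l r) atTop
      (𝓝 (∫ r in (0 : ℝ)..T, h r.toNNReal * l r)) := by
  refine intervalIntegral.tendsto_integral_filter_of_dominated_convergence (fun r => K * |l r|)
    (.of_forall fun n => ?_) (.of_forall fun n => .of_forall fun r hr => ?_)
    ((hl.abs.const_mul K).intervalIntegrable _ _) (.of_forall fun r _ => ?_)
  · exact (((measurable_comp_gridBelow T n h).comp measurable_real_toNNReal).mul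
      hl.measurable).aestronglyMeasurable
  · rw [Set.uIoc_of_le T.coe_nonneg] at hr
    rw [Real.norm_eq_abs, abs_mul]
    exact mul_le_mul_of_nonneg_right (hK _ ((gridBelow_le hT n _).trans
      (Real.toNNReal_le_iff_le_coe.2 hr.2))) (abs_nonneg _)
  · exact ((hlc _).tendsto.comp (tendsto_gridBelow hT _)).mul_const _

end RiemannSums

/-! ### Conditional second moment of an integral against a Poisson process -/

lemma continuous_comp_toNNReal {f : ℝ≥0 → ℝ} (hf : Continuous f) :
    Continuous fun r : ℝ => f r.toNNReal := hf.comp continuous_real_toNNReal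

lemma measurable_cumIntensity {Ω : Type*} {G : MeasurableSpace Ω} {lam : ℝ≥0 → Ω → ℝ}
    {s t T : ℝ≥0} (hlm : ∀ s ≤ T, Measurable[G] (lam s))
    (hlc : ∀ ω, Continuous fun t => lam t ω) (hsT : s ≤ T) (htT : t ≤ T) :
    Measurable[G] (cumIntensity lam s t) := by
  have h0 : ∀ t ≤ T, Measurable[G] (cumIntensity lam 0 t) := fun t ht => by
    rcases eq_or_lt_of_le (zero_le : 0 ≤ t) with rfl | ht0
    · have : cumIntensity lam 0 0 = fun _ => 0 := by
        ext ω
        simp [cumIntensity]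
      rw [this]
      exact measurable_const
    · exact @measurable_integral_leftCont t Ω G ht0 lam (fun s hs => hlm s (hs.trans ht))
        fun ω t => (hlc ω).continuousWithinAt
  have : cumIntensity lam s t = fun ω => cumIntensity lam 0 t ω - cumIntensity lam 0 s ω := by
    ext ω
    have hc := continuous_comp_toNNReal (hlc ω)
    exact (intervalIntegral.integral_interval_sub_left (hc.intervalIntegrable _ _)
      (hc.intervalIntegrable _ _)).symm
  rw [this]
  exact Measurable.sub (h0 t htT) (h0 s hsT)

section PoissonIntegral

variable {Ω : Type*} {G : MeasurableSpace Ω} [mΩ : MeasurableSpace Ω] {μ : Measure Ω}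
  [IsProbabilityMeasure μ] {N : ℝ≥0 → Ω → ℕ} {lam : ℝ≥0 → Ω → ℝ} {s t T : ℝ≥0}
  {h : ℝ≥0 → Ω → ℝ} {c : Ω → ℝ} {A : Set Ω}

/-- The bounded case: on `A` all ingredients are bounded by `K`. -/
lemma setLIntegral_sq_tickSum_of_bounded (hG : G ≤ mΩ) (hN : IsCountingProcess N)
    (hNm : ∀ t, Measurable (N t)) (hP : IsDoublyStochasticPoisson μ G N lam)
    (hpos : ∀ ω t, 0 < lam t ω) (hlc : ∀ ω, Continuous fun t => lam t ω) (hT : 0 < T)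
    (hlm : ∀ s ≤ T, Measurable[G] (lam s)) (hhm : ∀ s ≤ T, Measurable[G] (h s))
    (hhl : ∀ ω t, ContinuousWithinAt (fun s => h s ω) (Set.Iic t) t) (hc : Measurable[G] c)
    (hA : MeasurableSet[G] A) {K : ℝ} (hK : 0 ≤ K) (hhK : ∀ ω ∈ A, ∀ s ≤ T, |h s ω| ≤ K)
    (hLK : ∀ ω ∈ A, cumIntensity lam 0 T ω ≤ K) (hcK : ∀ ω ∈ A, |c ω| ≤ K) :
    ∫⁻ ω in A, ENNReal.ofReal
        ((∑ i ∈ Finset.Ioc 0 (N T ω), h (arrival N i ω) ω - c ω) ^ 2) ∂μ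
      = ∫⁻ ω in A, ENNReal.ofReal
        (((∫ r in (0 : ℝ)..T, h r.toNNReal ω * lam r.toNNReal ω) - c ω) ^ 2
          + ∫ r in (0 : ℝ)..T, h r.toNNReal ω ^ 2 * lam r.toNNReal ω) ∂μ := by
  have hA' : MeasurableSet A := hG A hA
  set L : ℕ → ℕ → Ω → ℝ := fun n k =>
    cumIntensity lam (k * mesh T n) ((k + 1 : ℕ) * mesh T n) with hL
  have hLm : ∀ n, ∀ k < n + 1, Measurable[G] (L n k) := fun n k hk =>
    measurable_cumIntensity hlm hlc (grid_le hk.le) (grid_le hk)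
  have hL0 : ∀ n k ω, 0 ≤ L n k ω := fun n k ω =>
    cumIntensity_nonneg hpos (monotone_grid T n (Nat.le_succ k)) ω
  have hhm' : ∀ n, ∀ k < n + 1, Measurable[G] (h ((k : ℕ) * mesh T n)) := fun n k hk =>
    hhm _ (grid_le (Nat.le_of_lt hk))
  have hΔ : ∀ n (k : ℕ) ω, 0 ≤ (N ((k + 1 : ℕ) * mesh T n) ω : ℝ) - N (k * mesh T n) ω :=
    fun n k ω => sub_nonneg.2 (Nat.cast_le.2 (hN.mono ω (monotone_grid T n (Nat.le_succ k))))
  set U : ℕ → Ω → ℝ := fun n ω => ∑ k ∈ Finset.range (n + 1), h (k * mesh T n) ω *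
    ((N ((k + 1 : ℕ) * mesh T n) ω : ℝ) - N (k * mesh T n) ω) with hU
  set V : ℕ → Ω → ℝ := fun n ω => ∑ k ∈ Finset.range (n + 1), h (k * mesh T n) ω * L n k ω with hV
  set W : ℕ → Ω → ℝ := fun n ω => ∑ k ∈ Finset.range (n + 1), h (k * mesh T n) ω ^ 2 * L n k ω
    with hW
  have hUm : ∀ n, Measurable (U n) := fun n => Finset.measurable_sum _ fun k hk =>
    ((hhm' n k (Finset.mem_range.1 hk)).mono hG le_rfl).mul
      ((measurable_from_nat.comp (hNm _)).sub (measurable_from_nat.comp (hNm _)))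
  have hVm : ∀ n, Measurable (V n) := fun n => Finset.measurable_sum _ fun k hk =>
    ((hhm' n k (Finset.mem_range.1 hk)).mono hG le_rfl).mul
      ((hLm n k (Finset.mem_range.1 hk)).mono hG le_rfl)
  have hWm : ∀ n, Measurable (W n) := fun n => Finset.measurable_sum _ fun k hk =>
    (((hhm' n k (Finset.mem_range.1 hk)).mono hG le_rfl).pow_const 2).mul
      ((hLm n k (Finset.mem_range.1 hk)).mono hG le_rfl)
  have hcm : Measurable c := hc.mono hG le_rfl
  -- The second-moment identity on the n-th grid; the limits of both sides give the claim.
  have hdisc : ∀ n, ∫⁻ ω in A, ENNReal.ofReal ((U n ω - c ω) ^ 2) ∂μ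
      = ∫⁻ ω in A, ENNReal.ofReal ((V n ω - c ω) ^ 2 + W n ω) ∂μ := fun n =>
    setLIntegral_sq_sum_increments hG hN hNm hP hpos (monotone_grid T n) (hLm n) (hhm' n) hc hA
  have hhk : ∀ n, ∀ k ∈ Finset.range (n + 1), ∀ ω ∈ A, |h ((k : ℕ) * mesh T n) ω| ≤ K :=
    fun n k hk ω hω => hhK ω hω _ (grid_le (Finset.mem_range.1 hk).le)
  have hsumL : ∀ n ω, ∑ k ∈ Finset.range (n + 1), L n k ω = cumIntensity lam 0 T ω := fun n ω => by
    have := integral_grid (h := fun _ => 1) hT (continuous_comp_toNNReal (hlc ω)) n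
    simpa [hL, cumIntensity] using this
  have hsumN : ∀ n ω, ∑ k ∈ Finset.range (n + 1),
      ((N ((k + 1 : ℕ) * mesh T n) ω : ℝ) - N (k * mesh T n) ω) = N T ω := fun n ω => by
    have := hN.sum_grid (h := fun _ => 1) hT n ω
    simp only [one_mul] at this
    rw [this]
    simp
  have hUb : ∀ n, ∀ ω ∈ A, |U n ω| ≤ K * N T ω := fun n ω hω => by
    rw [← hsumN n ω, Finset.mul_sum]
    refine (Finset.abs_sum_le_sum_abs _ _).trans (Finset.sum_le_sum fun k hk => ?_)
    rw [abs_mul, abs_of_nonneg (hΔ n k ω)]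
    exact mul_le_mul_of_nonneg_right (hhk n k hk ω hω) (hΔ n k ω)
  have hVb : ∀ n, ∀ ω ∈ A, |V n ω| ≤ K * K := fun n ω hω => by
    refine le_trans ?_ (mul_le_mul_of_nonneg_left (hLK ω hω) hK)
    rw [← hsumL n ω, Finset.mul_sum]
    refine (Finset.abs_sum_le_sum_abs _ _).trans (Finset.sum_le_sum fun k hk => ?_)
    rw [abs_mul, abs_of_nonneg (hL0 n k ω)]
    exact mul_le_mul_of_nonneg_right (hhk n k hk ω hω) (hL0 n k ω)
  have hWb : ∀ n, ∀ ω ∈ A, W n ω ≤ K ^ 2 * K := fun n ω hω => by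
    refine le_trans ?_ (mul_le_mul_of_nonneg_left (hLK ω hω) (sq_nonneg K))
    rw [← hsumL n ω, Finset.mul_sum]
    refine Finset.sum_le_sum fun k hk => mul_le_mul_of_nonneg_right ?_ (hL0 n k ω)
    exact sq_le_sq' (abs_le.1 (hhk n k hk ω hω)).1 (abs_le.1 (hhk n k hk ω hω)).2
  have hsq : ∀ x y z : ℝ, |x| ≤ z → |y| ≤ K → (x - y) ^ 2 ≤ (K + z) ^ 2 := fun x y z hx hy => by
    rw [abs_le] at hx hy
    exact sq_le_sq' (by linarith) (by linarith)
  have hUlim : ∀ ω, Tendsto (fun n => U n ω) atTop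
      (𝓝 (∑ i ∈ Finset.Ioc 0 (N T ω), h (arrival N i ω) ω)) := fun ω =>
    (tendsto_sum_gridBelow hT (hhl ω) _ _).congr fun n =>
      (hN.sum_grid (h := fun t => h t ω) hT n ω).symm
  have hVlim : ∀ ω ∈ A, Tendsto (fun n => V n ω) atTop
      (𝓝 (∫ r in (0 : ℝ)..T, h r.toNNReal ω * lam r.toNNReal ω)) := fun ω hω =>
    (tendsto_integral_gridBelow (h := fun t => h t ω) hT (hhl ω)
      (continuous_comp_toNNReal (hlc ω)) (hhK ω hω)).congr
      fun n => (integral_grid (h := fun t => h t ω) hT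
        (continuous_comp_toNNReal (hlc ω)) n).symm
  have hWlim : ∀ ω ∈ A, Tendsto (fun n => W n ω) atTop
      (𝓝 (∫ r in (0 : ℝ)..T, h r.toNNReal ω ^ 2 * lam r.toNNReal ω)) := fun ω hω =>
    (tendsto_integral_gridBelow (h := fun t => h t ω ^ 2) hT (fun t => (hhl ω t).pow 2)
      (continuous_comp_toNNReal (hlc ω)) (K := K ^ 2) fun s hs => by
        rw [abs_pow]
        exact pow_le_pow_left₀ (abs_nonneg _) (hhK ω hω s hs) 2).congr
      fun n => (integral_grid (h := fun t => h t ω ^ 2) hT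
        (continuous_comp_toNNReal (hlc ω)) n).symm
  -- N(T) bounds the grid sums uniformly in n. The dominating function is written with N(T) - N(0)
  -- so that the one-increment formula, with X = a = K, computes its integral and shows it finite.
  have hleft := tendsto_lintegral_of_dominated_convergence (μ := μ.restrict A)
    (F := fun n ω => ENNReal.ofReal ((U n ω - c ω) ^ 2))
    (fun ω => ENNReal.ofReal ((K + K * ((N T ω : ℝ) - N 0 ω)) ^ 2))
    (fun n => (((hUm n).sub hcm).pow_const 2).ennreal_ofReal)
    (fun n => (ae_restrict_iff' hA').2 (.of_forall fun ω hω => ENNReal.ofReal_le_ofReal (by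
      rw [hN.zero, Nat.cast_zero, sub_zero]
      exact hsq _ _ _ (hUb n ω hω) (hcK ω hω)))) ?_
    (.of_forall fun ω => (ENNReal.continuous_ofReal.tendsto _).comp
      (((hUlim ω).sub_const (c ω)).pow 2))
  · have hright := tendsto_lintegral_of_dominated_convergence (μ := μ.restrict A)
      (F := fun n ω => ENNReal.ofReal ((V n ω - c ω) ^ 2 + W n ω))
      (fun _ => ENNReal.ofReal ((K + K * K) ^ 2 + K ^ 2 * K))
      (fun n => ((((hVm n).sub hcm).pow_const 2).add (hWm n)).ennreal_ofReal)
      (fun n => (ae_restrict_iff' hA').2 (.of_forall fun ω hω => ENNReal.ofReal_le_ofReal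
        (add_le_add (hsq _ _ _ (hVb n ω hω) (hcK ω hω)) (hWb n ω hω))))
      (by rw [lintegral_const]; exact ENNReal.mul_ne_top ENNReal.ofReal_ne_top (measure_ne_top _ _))
      ((ae_restrict_iff' hA').2 (.of_forall fun ω hω => (ENNReal.continuous_ofReal.tendsto _).comp
        ((((hVlim ω hω).sub_const (c ω)).pow 2).add (hWlim ω hω))))
    exact tendsto_nhds_unique (hleft.congr hdisc) hright
  · have hGH : G ≤ G ⊔ sigmaOf N (Set.Iic 0) := le_sup_left
    rw [setLIntegral_sq_add_increment hG hN hNm hP (zero_le : 0 ≤ T) hpos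
      ((measurable_cumIntensity hlm hlc zero_le le_rfl).mono hG le_rfl) measurable_const
      measurable_const (hGH A hA)]
    refine ne_top_of_le_ne_top ?_ (setLIntegral_mono' hA' fun ω hω =>
      ENNReal.ofReal_le_ofReal (q := (K + K * K) ^ 2 + K ^ 2 * K) ?_)
    · rw [lintegral_const]
      exact ENNReal.mul_ne_top ENNReal.ofReal_ne_top (measure_ne_top _ _)
    · have h0 := cumIntensity_nonneg (s := 0) (t := T) hpos zero_le ω
      have h1 := hLK ω hω
      gcongr

/-- Second moment of a centred integral against `N`, given `G`. -/
theorem setLIntegral_sq_tickSum (hG : G ≤ mΩ) (hN : IsCountingProcess N)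
    (hNm : ∀ t, Measurable (N t)) (hP : IsDoublyStochasticPoisson μ G N lam)
    (hpos : ∀ ω t, 0 < lam t ω) (hlc : ∀ ω, Continuous fun t => lam t ω) (hT : 0 < T)
    (hlm : ∀ s ≤ T, Measurable[G] (lam s)) (hhm : ∀ s ≤ T, Measurable[G] (h s))
    (hhl : ∀ ω t, ContinuousWithinAt (fun s => h s ω) (Set.Iic t) t) (hc : Measurable[G] c)
    (hA : MeasurableSet[G] A) {b : Ω → ℝ} (hb : Measurable[G] b)
    (hhb : ∀ ω, ∀ s ≤ T, |h s ω| ≤ b ω) :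
    ∫⁻ ω in A, ENNReal.ofReal
        ((∑ i ∈ Finset.Ioc 0 (N T ω), h (arrival N i ω) ω - c ω) ^ 2) ∂μ
      = ∫⁻ ω in A, ENNReal.ofReal
        (((∫ r in (0 : ℝ)..T, h r.toNNReal ω * lam r.toNNReal ω) - c ω) ^ 2
          + ∫ r in (0 : ℝ)..T, h r.toNNReal ω ^ 2 * lam r.toNNReal ω) ∂μ := by
  -- Events in G on which K bounds all ingredients. They increase to A, so the identity passes to A
  -- by monotone convergence, infinite values included.
  set S : ℕ → Set Ω := fun K => A ∩ {ω | b ω ≤ K ∧ cumIntensity lam 0 T ω ≤ K ∧ |c ω| ≤ K}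
    with hS
  have hSm : ∀ K, MeasurableSet[G] (S K) := fun K => by
    have h1 : MeasurableSet[G] {ω | b ω ≤ K} := measurableSet_le hb measurable_const
    have h2 : MeasurableSet[G] {ω | cumIntensity lam 0 T ω ≤ K} :=
      measurableSet_le (measurable_cumIntensity hlm hlc zero_le le_rfl) measurable_const
    have h3 : MeasurableSet[G] {ω | |c ω| ≤ K} :=
      measurableSet_le (continuous_abs.measurable.comp hc) measurable_const
    exact MeasurableSet.inter hA (MeasurableSet.inter h1 (MeasurableSet.inter h2 h3))
  have hmono : Monotone S := fun K K' hKK ω hω => by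
    have hK : (K : ℝ) ≤ K' := by exact_mod_cast hKK
    exact ⟨hω.1, hω.2.1.trans hK, hω.2.2.1.trans hK, hω.2.2.2.trans hK⟩
  have hU : ⋃ K, S K = A := by
    ext ω
    simp only [Set.mem_iUnion]
    refine ⟨fun ⟨K, hK⟩ => hK.1, fun hω => ?_⟩
    obtain ⟨K, hK⟩ := exists_nat_ge (max (b ω) (max (cumIntensity lam 0 T ω) |c ω|))
    simp only [max_le_iff] at hK
    exact ⟨K, hω, hK.1, hK.2.1, hK.2.2⟩
  rw [← hU, setLIntegral_iUnion_of_directed _ hmono.directed_le,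
    setLIntegral_iUnion_of_directed _ hmono.directed_le]
  exact iSup_congr fun K => setLIntegral_sq_tickSum_of_bounded hG hN hNm hP hpos hlc hT hlm hhm
    hhl hc (hSm K) (Nat.cast_nonneg K) (fun ω hω s hs => (hhb ω s hs).trans hω.2.1)
    (fun ω hω => hω.2.2.1)
    fun ω hω => hω.2.2.2

end PoissonIntegral

/-! ### Cutting a process at two times -/

section Cut

variable {Ω : Type*} {X lam vs : ℝ≥0 → Ω → ℝ} {σ ρ : Ω → ℝ≥0} {T : ℝ≥0} {ω : Ω}

/-- The process `X` restricted to the interval `(σ, ρ]`. -/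
noncomputable def cut (X : ℝ≥0 → Ω → ℝ) (σ ρ : Ω → ℝ≥0) (r : ℝ≥0) (ω : Ω) : ℝ :=
  if σ ω < r ∧ r ≤ ρ ω then X r ω else 0

/-- The interval is open on the left and closed on the right, so its indicator is left-continuous,
the path regularity that the Poisson moment formula asks of its integrand. -/
lemma cut_leftCont (hX : ∀ t, ContinuousWithinAt (fun r => X r ω) (Set.Iic t) t) (t : ℝ≥0) :
    ContinuousWithinAt (fun r => cut X σ ρ r ω) (Set.Iic t) t := by
  by_cases h1 : σ ω < t
  · by_cases h2 : t ≤ ρ ω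
    · refine (hX t).congr_of_eventuallyEq ?_ (by simp [cut, h1, h2])
      filter_upwards [self_mem_nhdsWithin, nhdsWithin_le_nhds (lt_mem_nhds h1)] with r hr hr'
      exact if_pos ⟨hr', le_trans hr h2⟩
    · refine (continuousWithinAt_const (b := (0 : ℝ))).congr_of_eventuallyEq ?_ (by simp [cut, h2])
      filter_upwards [nhdsWithin_le_nhds (lt_mem_nhds (not_le.1 h2))] with r hr
      exact if_neg fun h => absurd h.2 (not_le.2 hr)
  · refine (continuousWithinAt_const (b := (0 : ℝ))).congr_of_eventuallyEq ?_ (by simp [cut, h1])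
    filter_upwards [self_mem_nhdsWithin] with r hr
    exact if_neg fun h => h1 (lt_of_lt_of_le h.1 hr)

lemma measurable_cut {m : MeasurableSpace Ω} (hσ : Measurable σ) (hρ : Measurable ρ) {r : ℝ≥0}
    (hX : Measurable (X r)) : Measurable (cut X σ ρ r) := by
  have h1 : MeasurableSet {ω | σ ω < r} := measurableSet_lt hσ measurable_const
  have h2 : MeasurableSet {ω | r ≤ ρ ω} := measurableSet_le measurable_const hρ
  exact Measurable.ite (h1.inter h2) hX measurable_const

lemma abs_cut_le (r : ℝ≥0) (ω : Ω) : |cut X σ ρ r ω| ≤ |X r ω| := by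
  unfold cut
  split_ifs <;> simp

lemma cut_sq (r : ℝ≥0) (ω : Ω) :
    cut X σ ρ r ω ^ 2 = cut (fun r ω => X r ω ^ 2) σ ρ r ω := by
  unfold cut
  split_ifs <;> simp

lemma integral_cut (hσρ : σ ω ≤ ρ ω) (hρT : ρ ω ≤ T) :
    ∫ r in (0 : ℝ)..T, cut X σ ρ r.toNNReal ω * lam r.toNNReal ω
      = ∫ r in (σ ω : ℝ)..(ρ ω : ℝ), X r.toNNReal ω * lam r.toNNReal ω := by
  rw [intervalIntegral.integral_of_le T.coe_nonneg,
    intervalIntegral.integral_of_le (NNReal.coe_le_coe.2 hσρ)]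
  have hsub : Set.Ioc (0 : ℝ) T ∩ Set.Ioc (σ ω : ℝ) (ρ ω) = Set.Ioc (σ ω : ℝ) (ρ ω) :=
    Set.inter_eq_right.2 (Set.Ioc_subset_Ioc (σ ω).coe_nonneg (NNReal.coe_le_coe.2 hρT))
  rw [← hsub, ← setIntegral_indicator measurableSet_Ioc]
  refine setIntegral_congr_fun measurableSet_Ioc fun r hr => ?_
  have h1 : σ ω < r.toNNReal ↔ (σ ω : ℝ) < r := Real.lt_toNNReal_iff_coe_lt
  have h2 : r.toNNReal ≤ ρ ω ↔ r ≤ ρ ω := Real.toNNReal_le_iff_le_coe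
  by_cases h : (σ ω : ℝ) < r ∧ r ≤ ρ ω
  · rw [Set.indicator_of_mem (Set.mem_Ioc.2 h), cut, if_pos ⟨h1.2 h.1, h2.2 h.2⟩]
  · rw [Set.indicator_of_notMem (fun h' => h (Set.mem_Ioc.1 h')), cut,
      if_neg fun h' => h ⟨h1.1 h'.1, h2.1 h'.2⟩, zero_mul]

/-- The i-th tick lies in (σ, ρ] exactly when N(σ) < i ≤ N(ρ). -/
lemma IsCountingProcess.sum_cut {N : ℝ≥0 → Ω → ℕ} (hN : IsCountingProcess N) (hρT : ρ ω ≤ T) :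
    ∑ i ∈ Finset.Ioc 0 (N T ω), cut (fun r ω => vs r ω ^ 2) σ ρ (arrival N i ω) ω
      = rIV vs N (σ ω) (ρ ω) ω := by
  unfold cut rIV tickSum
  rw [← Finset.sum_filter]
  refine Finset.sum_congr ?_ fun _ _ => rfl
  have hle := hN.mono ω hρT
  simp only at hle
  ext i
  simp only [Finset.mem_filter, Finset.mem_Ioc]
  constructor
  · rintro ⟨⟨_, h2⟩, h3, h4⟩
    exact ⟨(hN.arrival_lt_iff h2).1 h3, (hN.arrival_le_iff h2).1 h4⟩
  · rintro ⟨h1, h2⟩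
    exact ⟨⟨by omega, h2.trans hle⟩, (hN.arrival_lt_iff h2).2 h1, arrival_le h2⟩

end Cut

/-! ### A measurable bound for a continuous process on `[0, T]` -/

section Sup

variable {Ω : Type*} {X : ℝ≥0 → Ω → ℝ} {T : ℝ≥0}

/-- The supremum of `X` over `[0, T]`, computed along a dense sequence. -/
noncomputable def pathSup (X : ℝ≥0 → Ω → ℝ) (T : ℝ≥0) (ω : Ω) : ℝ :=
  ⨆ n : ℕ, X (min (TopologicalSpace.denseSeq ℝ≥0 n) T) ω

lemma measurable_pathSup {m : MeasurableSpace Ω} (hX : ∀ s ≤ T, Measurable (X s)) :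
    Measurable (pathSup X T) :=
  Measurable.iSup fun _ => hX _ (min_le_right _ _)

/-- Compactness of [0, T] makes the countable supremum finite, and continuity extends the bound from
the dense sequence to all times. -/
lemma le_pathSup {ω : Ω} (hc : Continuous fun t => X t ω) {s : ℝ≥0} (hs : s ≤ T) :
    X s ω ≤ pathSup X T ω := by
  have hbdd : BddAbove (Set.range fun n : ℕ => X (min (TopologicalSpace.denseSeq ℝ≥0 n) T) ω) := by
    refine ((isCompact_Icc (a := (0 : ℝ≥0)) (b := T)).image hc).bddAbove.mono ?_
    rintro _ ⟨n, rfl⟩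
    exact ⟨_, ⟨zero_le, min_le_right _ _⟩, rfl⟩
  have hcl : IsClosed {s : ℝ≥0 | X (min s T) ω ≤ pathSup X T ω} :=
    isClosed_le (hc.comp (continuous_id.min continuous_const)) continuous_const
  have hsub : Set.range (TopologicalSpace.denseSeq ℝ≥0)
      ⊆ {s : ℝ≥0 | X (min s T) ω ≤ pathSup X T ω} := by
    rintro _ ⟨n, rfl⟩
    exact le_ciSup hbdd n
  have h := hcl.closure_subset_iff.2 hsub
    (by rw [(TopologicalSpace.denseRange_denseSeq ℝ≥0).closure_range]; exact Set.mem_univ s)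
  have h' : X (min s T) ω ≤ pathSup X T ω := h
  rwa [min_eq_left hs] at h'

end Sup

/-! ### Integrated variance of continuous intensities -/

section IVPaths

variable {Ω : Type*} {lam vs : ℝ≥0 → Ω → ℝ} {T s t : ℝ≥0} {ω : Ω}

lemma continuous_IV_integrand (hl : Continuous fun t => lam t ω) (hv : Continuous fun t => vs t ω) :
    Continuous fun r : ℝ => vs r.toNNReal ω ^ 2 * lam r.toNNReal ω :=
  continuous_comp_toNNReal (f := fun r => vs r ω ^ 2 * lam r ω) ((hv.pow 2).mul hl)

lemma IV_add (hl : Continuous fun t => lam t ω) (hv : Continuous fun t => vs t ω) :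
    IV lam vs 0 s ω + IV lam vs s t ω = IV lam vs 0 t ω :=
  intervalIntegral.integral_add_adjacent_intervals
    ((continuous_IV_integrand hl hv).intervalIntegrable _ _)
    ((continuous_IV_integrand hl hv).intervalIntegrable _ _)

lemma IV_self : IV lam vs s s ω = 0 := intervalIntegral.integral_same

lemma IV_strictMono (hl : Continuous fun t => lam t ω) (hv : Continuous fun t => vs t ω)
    (hlp : ∀ t, 0 < lam t ω) (hvp : ∀ t, 0 < vs t ω) : StrictMono fun t => IV lam vs 0 t ω := by
  intro s t hst
  have h : 0 < IV lam vs s t ω := intervalIntegral.intervalIntegral_pos_of_pos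
    ((continuous_IV_integrand hl hv).intervalIntegrable _ _)
    (fun r => mul_pos (pow_pos (hvp _) 2) (hlp _)) (NNReal.coe_lt_coe.2 hst)
  have := IV_add (s := s) (t := t) hl hv
  simp only
  linarith

lemma continuous_IV (hl : Continuous fun t => lam t ω) (hv : Continuous fun t => vs t ω) :
    Continuous fun t => IV lam vs 0 t ω :=
  (intervalIntegral.continuous_primitive (fun a b =>
    (continuous_IV_integrand hl hv).intervalIntegrable a b) 0).comp NNReal.continuous_coe

lemma IV_pos (hl : Continuous fun t => lam t ω) (hv : Continuous fun t => vs t ω)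
    (hlp : ∀ t, 0 < lam t ω) (hvp : ∀ t, 0 < vs t ω) (hT : 0 < T) : 0 < IV lam vs 0 T ω := by
  have := IV_strictMono hl hv hlp hvp hT
  simpa [IV_self] using this

end IVPaths

/-! ### Intensity business times -/

section IBTS

variable {Ω : Type*} {lam vs : ℝ≥0 → Ω → ℝ} {T : ℝ≥0} {M j : ℕ} {ω : Ω}

lemma iBTS_zero (hM : 0 < M) : iBTS lam vs T M 0 ω = 0 :=
  samplingTimes_zero hM (by simp [IV_self])

lemma iBTS_self : iBTS lam vs T M M ω = T := samplingTimes_self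

/-- Intensity business time sampling is equidistant in integrated variance. -/
lemma IV_iBTS (hl : Continuous fun t => lam t ω) (hv : Continuous fun t => vs t ω)
    (hlp : ∀ t, 0 < lam t ω) (hvp : ∀ t, 0 < vs t ω) (hT : 0 < T) (hM : 0 < M) (hj : j ≤ M) :
    IV lam vs 0 (iBTS lam vs T M j ω) ω = j * (IV lam vs 0 T ω / M) := by
  have hpos := IV_pos hl hv hlp hvp hT
  have hT' : (0 : ℝ) < T := hT
  have hM' : (0 : ℝ) < M := Nat.cast_pos.2 hM
  have hmono := IV_strictMono hl hv hlp hvp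
  have hcont := continuous_IV hl hv
  rcases hj.eq_or_lt with rfl | hjM
  · rw [iBTS_self]
    field_simp
  refine le_antisymm ?_ ?_
  · have hlev : (j : ℝ) * (IV lam vs 0 T ω / M) ∈ Set.Icc (IV lam vs 0 0 ω) (IV lam vs 0 T ω) := by
      rw [IV_self]
      refine ⟨by positivity, ?_⟩
      rw [← mul_div_assoc, div_le_iff₀ hM', mul_comm]
      exact mul_le_mul_of_nonneg_left (Nat.cast_le.2 hj) hpos.le
    obtain ⟨t, ht, hteq⟩ := intermediate_value_Icc (zero_le : 0 ≤ T) hcont.continuousOn hlev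
    simp only at hteq
    rw [← hteq]
    refine hmono.monotone (samplingTimes_le_of_le hjM.ne ht.2 ?_)
    rw [hteq]
    field_simp
    rfl
  · have h := le_apply_samplingTimes (M := M)
      (Φ := fun t ω => T * IV lam vs 0 t ω / IV lam vs 0 T ω)
      (T := T) (ω := ω) (fun t => ((hcont.const_mul _).div_const _).continuousWithinAt) hj
      (by field_simp)
    change _ ≤ (T : ℝ) * IV lam vs 0 (iBTS lam vs T M j ω) ω / IV lam vs 0 T ω at h
    rw [le_div_iff₀ hpos] at h
    have h2 : (T : ℝ) * (j * (IV lam vs 0 T ω / M)) ≤ T * IV lam vs 0 (iBTS lam vs T M j ω) ω := by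
      refine le_trans (le_of_eq ?_) h
      field_simp
    exact le_of_mul_le_mul_left h2 hT'

lemma isGridAt_iBTS (hl : Continuous fun t => lam t ω) (hv : Continuous fun t => vs t ω)
    (hlp : ∀ t, 0 < lam t ω) (hvp : ∀ t, 0 < vs t ω) (hT : 0 < T) (hM : 0 < M) :
    IsGridAt T M (iBTS lam vs T M) ω := by
  refine ⟨iBTS_zero hM, iBTS_self, fun j hj => (IV_strictMono hl hv hlp hvp).lt_iff_lt.1 ?_⟩
  rw [IV_iBTS hl hv hlp hvp hT hM hj.le, IV_iBTS hl hv hlp hvp hT hM hj]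
  have := IV_pos hl hv hlp hvp hT
  gcongr
  simp

end IBTS

/-! ### Sampling given (λ, ς) -/

section PartB

variable {Ω : Type*} [mΩ : MeasurableSpace Ω] {μ : Measure Ω} {F : Filtration ℝ≥0 mΩ}
  {lam vs : ℝ≥0 → Ω → ℝ} {N : ℝ≥0 → Ω → ℕ} {B : ℝ≥0 → Ω → ℝ} {P₀ : Ω → ℝ} {T : ℝ≥0} {M : ℕ}

lemma IsModel.measurable_IV_zero (h : IsModel μ F lam vs N B) {t : ℝ≥0} (ht : t ≤ T) :
    Measurable[sigmaLV lam vs (Set.Iic T)] (IV lam vs 0 t) := by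
  rcases (zero_le : 0 ≤ t).eq_or_lt with rfl | h0
  · have : IV lam vs 0 0 = fun _ : Ω => (0 : ℝ) := funext fun _ => IV_self
    rw [this]
    exact measurable_const
  · exact (h.measurable_IV h0).mono (sigmaLV_mono (Set.Iic_subset_Iic.2 ht)) le_rfl

lemma IsModel.isSamplingScheme_iBTS (h : IsModel μ F lam vs N B)
    (hl : ∀ ω, Continuous fun t => lam t ω) (hT : 0 < T) (hM : 0 < M) :
    IsSamplingScheme μ (sigmaLV lam vs (Set.Iic T)) T M (iBTS lam vs T M) where
  measurable j _ := @measurable_samplingTimes Ω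
    (fun t ω => T * IV lam vs 0 t ω / IV lam vs 0 T ω) T M (sigmaLV lam vs (Set.Iic T))
    (fun ω _ _ hst => div_le_div_of_nonneg_right (mul_le_mul_of_nonneg_left
      ((IV_strictMono (hl ω) (h.vs_cont ω) (h.lam_pos ω) (h.vs_pos ω)).monotone hst) T.coe_nonneg)
      (IV_pos (hl ω) (h.vs_cont ω) (h.lam_pos ω) (h.vs_pos ω) hT).le)
    (fun ω _ => (((continuous_IV (hl ω) (h.vs_cont ω)).const_mul _).div_const _).continuousWithinAt)
    (fun _ ht => Measurable.div (Measurable.const_mul (h.measurable_IV_zero ht) _)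
      (h.measurable_IV_zero le_rfl)) j
  grid := .of_forall fun ω => isGridAt_iBTS (hl ω) (h.vs_cont ω) (h.lam_pos ω) (h.vs_pos ω) hT hM

/-- The conditional mean squared error given `(λ, ς)`, for weakly increasing times. -/
theorem condMSE_sigmaLV_eq [IsProbabilityMeasure μ] (h : IsModel μ F lam vs N B)
    (hind : IsIndependentNoise μ lam vs N B) (hp : HasPoissonArrivals μ lam vs N) (hT : 0 < T)
    {τ : ℕ → Ω → ℝ≥0} (hτ : ∀ j ≤ M, Measurable[sigmaLV lam vs (Set.Iic T)] (τ j))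
    (hgrid : ∀ᵐ ω ∂μ, τ 0 ω = 0 ∧ τ M ω = T ∧ ∀ j < M, τ j ω ≤ τ (j + 1) ω) :
    condMSE μ (sigmaLV lam vs (Set.Iic T)) P₀ lam vs N B T M τ =ᵐ[μ] fun ω =>
      ENNReal.ofReal (3 * (∫ r in (0 : ℝ)..T, (vs r.toNNReal ω ^ 2) ^ 2 * lam r.toNNReal ω)
        + 2 * ∑ j ∈ Finset.range M, IV lam vs (τ j ω) (τ (j + 1) ω) ω ^ 2) := by
  have hN := h.counting
  have hl := hp.lam_cont
  have hGN : sigmaLVN lam vs N (Set.Iic T) ≤ mΩ := h.sigmaLVN_le _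
  have hG : sigmaLV lam vs (Set.Iic T) ≤ mΩ := sigmaLV_le_sigmaLVN.trans hGN
  have hU : sigmaLV lam vs Set.univ ≤ mΩ :=
    sigmaLV_le (fun s _ => h.measurable_lam s) fun s _ => h.measurable_vs s
  -- The Poisson property is conditional on (λ, ς) at all times, while schemes and test events use
  -- times up to T only; the inclusion connects the two.
  have hGU : sigmaLV lam vs (Set.Iic T) ≤ sigmaLV lam vs Set.univ :=
    sigmaLV_mono (Set.subset_univ _)
  have hle : ∀ᵐ ω ∂μ, ∀ j ≤ M, τ j ω ≤ T := by
    filter_upwards [hgrid] with ω hω j hj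
    induction hj using Nat.decreasingInduction with
    | self => exact hω.2.1.le
    | of_succ k hk ih => exact (hω.2.2 k hk).trans ih
  -- The grid property holds almost surely only; truncation gives times bounded by T at every
  -- outcome.
  set σ : ℕ → Ω → ℝ≥0 := fun j ω => min (τ j ω) T with hσ
  have hσT : ∀ j ω, σ j ω ≤ T := fun j ω => min_le_right _ _
  have hσm : ∀ j ≤ M, Measurable[sigmaLV lam vs (Set.Iic T)] (σ j) := fun j hj =>
    Measurable.min (hτ j hj) measurable_const
  set w : ℝ≥0 → Ω → ℝ := fun r ω => vs r ω ^ 2 with hw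
  have hw0 : ∀ r ω, 0 ≤ w r ω := fun r ω => sq_nonneg _
  have hwc : ∀ ω, Continuous fun r => w r ω := fun ω => (h.vs_cont ω).pow 2
  have hwm : ∀ s ≤ T, Measurable[sigmaLV lam vs (Set.Iic T)] (w s) := fun s hs =>
    Measurable.pow_const (measurable_vs_sigmaLV hs) 2
  have hlm : ∀ s ≤ T, Measurable[sigmaLV lam vs (Set.Iic T)] (lam s) := fun s hs =>
    measurable_lam_sigmaLV hs
  -- Summed over the ticks, `H j` gives rIV of the j-th interval; integrated against λ, it gives IV
  -- there.
  set H : ℕ → ℝ≥0 → Ω → ℝ := fun j => cut w (σ j) (σ (j + 1)) with hH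
  have hHm : ∀ j < M, ∀ s ≤ T, Measurable[sigmaLV lam vs (Set.Iic T)] (H j s) := fun j hj s hs =>
    measurable_cut (hσm j hj.le) (hσm (j + 1) hj) (hwm s hs)
  have hHl : ∀ j ω t, ContinuousWithinAt (fun s => H j s ω) (Set.Iic t) t := fun j ω t =>
    cut_leftCont (fun t => (hwc ω).continuousWithinAt) t
  have hb : Measurable[sigmaLV lam vs Set.univ] (pathSup w T) :=
    (measurable_pathSup hwm).mono hGU le_rfl
  have hwb : ∀ ω, ∀ s ≤ T, |w s ω| ≤ pathSup w T ω := fun ω s hs => by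
    rw [abs_of_nonneg (hw0 s ω)]
    exact le_pathSup (hwc ω) hs
  have hQm : ∀ X : ℝ≥0 → Ω → ℝ, (∀ s ≤ T, Measurable[sigmaLV lam vs (Set.Iic T)] (X s)) →
      (∀ ω t, ContinuousWithinAt (fun s => X s ω) (Set.Iic t) t) →
      Measurable[sigmaLV lam vs (Set.Iic T)] fun ω =>
        ∫ r in (0 : ℝ)..T, X r.toNNReal ω * lam r.toNNReal ω := fun X hX hXc =>
    @measurable_integral_leftCont _ _ (sigmaLV lam vs (Set.Iic T)) hT (fun r ω => X r ω * lam r ω)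
      (fun s hs => Measurable.mul (hX s hs) (hlm s hs)) fun ω t =>
        (hXc ω t).mul (hl ω).continuousWithinAt
  set Q : Ω → ℝ := fun ω => ∫ r in (0 : ℝ)..T, w r.toNNReal ω ^ 2 * lam r.toNNReal ω with hQ
  set I : ℕ → Ω → ℝ := fun j ω => ∫ r in (0 : ℝ)..T, H j r.toNNReal ω * lam r.toNNReal ω with hI
  set R : ℕ → Ω → ℝ := fun j ω => ∫ r in (0 : ℝ)..T, H j r.toNNReal ω ^ 2 * lam r.toNNReal ω
    with hR
  have hQmeas : Measurable[sigmaLV lam vs (Set.Iic T)] Q :=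
    hQm _ (fun s hs => Measurable.pow_const (hwm s hs) 2) fun ω t =>
      ((hwc ω).pow 2).continuousWithinAt
  have hRmeas : ∀ j < M, Measurable[sigmaLV lam vs (Set.Iic T)] fun ω => I j ω ^ 2 + R j ω :=
    fun j hj => Measurable.add (Measurable.pow_const (hQm _ (hHm j hj) (hHl j)) 2)
      (hQm (fun s ω => H j s ω ^ 2) (fun s hs => Measurable.pow_const (hHm j hj s hs) 2)
        fun ω t => (hHl j ω t).pow 2)
  have hstep : condMSE μ (sigmaLV lam vs (Set.Iic T)) P₀ lam vs N B T M τ =ᵐ[μ] fun ω =>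
      ENNReal.ofReal (Q ω) + ∑ j ∈ Finset.range M, 2 * ENNReal.ofReal (I j ω ^ 2 + R j ω) := by
    refine (ae_eq_condLExp hG μ _ ?_ fun A hA => ?_).symm
    · exact Measurable.add (ENNReal.measurable_ofReal.comp hQmeas)
        (Finset.measurable_sum _ fun j hj => Measurable.const_mul
          (ENNReal.measurable_ofReal.comp (hRmeas j (Finset.mem_range.1 hj))) 2)
    have hAm := hG A hA
    have hv : ∀ j < M, Measurable fun ω => rIV vs N (σ j ω) (σ (j + 1) ω) ω := fun j hj => by
      have := hN.measurable_rIV (T := T) (fun t _ => h.measurable_N t)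
        (fun t _ => h.measurable_vs t)
        h.vs_cont ((hσm j hj.le).mono hG le_rfl) ((hσm (j + 1) hj).mono hG le_rfl)
      simpa only [min_eq_left (hσT _ _)] using this
    have h0 : Measurable fun ω => rIV vs N 0 T ω := by
      have := hN.measurable_rIV (T := T) (fun t _ => h.measurable_N t)
        (fun t _ => h.measurable_vs t)
        h.vs_cont (σ := fun _ => 0) (τ := fun _ => T) measurable_const measurable_const
      simpa using this
    have hIVm : Measurable (IV lam vs 0 T) := (h.measurable_IV hT).mono hG le_rfl
    have hsqm : Measurable fun ω =>
        ENNReal.ofReal ((rIV vs N 0 T ω - IV lam vs 0 T ω) ^ 2) :=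
      ((h0.sub hIVm).pow_const 2).ennreal_ofReal
    -- Centring at IV, the conditional mean of rIV, leaves the variance ∫ ς⁴λ alone.
    have hmain : ∫⁻ ω in A, ENNReal.ofReal ((rIV vs N 0 T ω - IV lam vs 0 T ω) ^ 2) ∂μ
        = ∫⁻ ω in A, ENNReal.ofReal (Q ω) ∂μ := by
      have := setLIntegral_sq_tickSum hU hN h.measurable_N hp.poisson h.lam_pos hl hT
        (fun s hs => (hlm s hs).mono hGU le_rfl) (fun s hs => (hwm s hs).mono hGU le_rfl)
        (fun ω t => (hwc ω).continuousWithinAt) ((h.measurable_IV hT).mono hGU le_rfl)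
        (hGU A hA) hb hwb
      have hz : ∀ ω, (N 0 ω) = 0 := hN.zero
      simp only [rIV, tickSum, hz]
      refine this.trans (lintegral_congr fun ω => ?_)
      congr 1
      have : ∫ r in (0 : ℝ)..T, w r.toNNReal ω * lam r.toNNReal ω = IV lam vs 0 T ω := rfl
      rw [this, sub_self]
      simp [hQ]
    -- Without centring, the second moment is squared mean plus variance.
    have hpart : ∀ j ∈ Finset.range M,
        ∫⁻ ω in A, 2 * ENNReal.ofReal (rIV vs N (σ j ω) (σ (j + 1) ω) ω ^ 2) ∂μ
        = ∫⁻ ω in A, 2 * ENNReal.ofReal (I j ω ^ 2 + R j ω) ∂μ := fun j hj => by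
      have hj' := Finset.mem_range.1 hj
      have := setLIntegral_sq_tickSum (c := fun _ => 0) hU hN h.measurable_N hp.poisson h.lam_pos
        hl hT (fun s hs => (hlm s hs).mono hGU le_rfl)
        (fun s hs => (hHm j hj' s hs).mono hGU le_rfl) (hHl j) measurable_const
        (hGU A hA) hb fun ω s hs => (abs_cut_le s ω).trans (hwb ω s hs)
      simp only [sub_zero] at this
      rw [lintegral_const_mul _ (((hv j hj').pow_const 2).ennreal_ofReal), lintegral_const_mul _
        (((hRmeas j hj').mono hG le_rfl).ennreal_ofReal), ← this]
      congr 1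
      refine lintegral_congr fun ω => ?_
      rw [← hN.sum_cut (vs := vs) (hσT (j + 1) ω)]
    -- Tower property: A also belongs to the σ-algebra of (λ, ς, N), so over A the squared error may
    -- be replaced by its explicit conditional expectation given (λ, ς, N).
    refine Eq.trans ?_ (setLIntegral_condLExp hGN μ _ (sigmaLV_le_sigmaLVN A hA))
    have hLVN := condMSE_eq (P₀ := P₀) h hind hT
      (fun j hj => (hτ j hj).mono sigmaLV_le_sigmaLVN le_rfl) (hgrid.mono fun ω hω => hω.2)
    rw [lintegral_add_left ((hQmeas.mono hG le_rfl).ennreal_ofReal),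
      lintegral_finsetSum' _ fun j hj => (((hRmeas j (Finset.mem_range.1 hj)).mono hG
        le_rfl).ennreal_ofReal.const_mul 2).aemeasurable, ← hmain, ← Finset.sum_congr rfl hpart,
      ← lintegral_finsetSum' _ fun j hj => (((hv j (Finset.mem_range.1 hj)).pow_const
        2).ennreal_ofReal.const_mul 2).aemeasurable,
      ← lintegral_add_left hsqm]
    refine lintegral_congr_ae (ae_restrict_of_ae ?_)
    filter_upwards [hLVN, hgrid, hle] with ω hω hg hωT
    unfold condMSE at hω
    have hsum := hN.sum_rIV (vs := vs) hg.1 hg.2.2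
    rw [hg.2.1] at hsum
    rw [hω, hsum, ENNReal.ofReal_add (sq_nonneg _)
      (mul_nonneg zero_le_two (Finset.sum_nonneg fun _ _ => sq_nonneg _)),
      ENNReal.ofReal_mul zero_le_two, ENNReal.ofReal_sum_of_nonneg fun _ _ => sq_nonneg _,
      Finset.mul_sum, ENNReal.ofReal_ofNat]
    congr 1
    refine Finset.sum_congr rfl fun j hj => ?_
    have hj' := Finset.mem_range.1 hj
    simp only [hσ, min_eq_left (hωT j hj'.le), min_eq_left (hωT (j + 1) hj')]
  refine hstep.trans ?_
  filter_upwards [hgrid, hle] with ω hg hωT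
  have hcont : Continuous fun r : ℝ => w r.toNNReal ω ^ 2 * lam r.toNNReal ω :=
    continuous_comp_toNNReal (f := fun r => w r ω ^ 2 * lam r ω) (((hwc ω).pow 2).mul (hl ω))
  have hστ : ∀ j ≤ M, σ j ω = τ j ω := fun j hj => min_eq_left (hωT j hj)
  have hσσ : ∀ j < M, σ j ω ≤ σ (j + 1) ω := fun j hj => by
    rw [hστ j hj.le, hστ (j + 1) hj]
    exact hg.2.2 j hj
  have hIeq : ∀ j ∈ Finset.range M, I j ω = IV lam vs (τ j ω) (τ (j + 1) ω) ω := fun j hj => by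
    have hj' := Finset.mem_range.1 hj
    rw [← hστ j hj'.le, ← hστ (j + 1) hj']
    exact integral_cut (hσσ j hj') (hσT _ _)
  have hReq : ∀ j ∈ Finset.range M, R j ω
      = ∫ r in (τ j ω : ℝ)..(τ (j + 1) ω : ℝ), w r.toNNReal ω ^ 2 * lam r.toNNReal ω :=
    fun j hj => by
      have hj' := Finset.mem_range.1 hj
      rw [← hστ j hj'.le, ← hστ (j + 1) hj']
      simp only [hR, hH, cut_sq]
      exact integral_cut (X := fun r ω => w r ω ^ 2) (hσσ j hj') (hσT _ _)
  -- The interval variances add up to Q whatever the times; doubled and added to the Q of the bias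
  -- term, they give the constant 3.
  have hRsum : ∑ j ∈ Finset.range M, R j ω = Q ω := by
    rw [Finset.sum_congr rfl hReq, intervalIntegral.sum_integral_adjacent_intervals
      (a := fun j => (τ j ω : ℝ)) fun j _ => hcont.intervalIntegrable _ _, hg.1, hg.2.1]
    rfl
  have hQ0 : 0 ≤ Q ω := intervalIntegral.integral_nonneg T.coe_nonneg fun r _ =>
    mul_nonneg (sq_nonneg _) (h.lam_pos _ _).le
  have hR0 : ∀ j, 0 ≤ R j ω := fun j => intervalIntegral.integral_nonneg T.coe_nonneg fun r _ =>
    mul_nonneg (sq_nonneg _) (h.lam_pos _ _).le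
  have hnn : ∀ j, 0 ≤ I j ω ^ 2 + R j ω := fun j => add_nonneg (sq_nonneg _) (hR0 j)
  rw [← Finset.mul_sum, ← ENNReal.ofReal_sum_of_nonneg fun j _ => hnn j, ← ENNReal.ofReal_ofNat,
    ← ENNReal.ofReal_mul (by norm_num), ← ENNReal.ofReal_add hQ0
      (mul_nonneg (by norm_num) (Finset.sum_nonneg fun j _ => hnn j)),
    Finset.sum_add_distrib, hRsum, Finset.sum_congr rfl fun j hj => by rw [hIeq j hj]]
  congr 1
  simp only [hQ]
  ring

/-- Intensity business time sampling is optimal given `(λ, ς)`. -/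
theorem sampling_given_intensity [IsProbabilityMeasure μ] (h : IsModel μ F lam vs N B)
    (hind : IsIndependentNoise μ lam vs N B) (hp : HasPoissonArrivals μ lam vs N) (hT : 0 < T)
    (hM : 0 < M) {τ : ℕ → Ω → ℝ≥0}
    (hτ : IsSamplingScheme μ (sigmaLV lam vs (Set.Iic T)) T M τ) :
    ∀ᵐ ω ∂μ,
      condMSE μ (sigmaLV lam vs (Set.Iic T)) P₀ lam vs N B T M (iBTS lam vs T M) ω ≤
          condMSE μ (sigmaLV lam vs (Set.Iic T)) P₀ lam vs N B T M τ ω ∧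
        (condMSE μ (sigmaLV lam vs (Set.Iic T)) P₀ lam vs N B T M τ ω =
            condMSE μ (sigmaLV lam vs (Set.Iic T)) P₀ lam vs N B T M (iBTS lam vs T M) ω ↔
          ∀ j ≤ M, τ j ω = iBTS lam vs T M j ω) := by
  have hl := hp.lam_cont
  have hi := h.isSamplingScheme_iBTS hl hT hM
  have hweak : ∀ {ρ : ℕ → Ω → ℝ≥0}, (∀ᵐ ω ∂μ, IsGridAt T M ρ ω) →
      ∀ᵐ ω ∂μ, ρ 0 ω = 0 ∧ ρ M ω = T ∧ ∀ j < M, ρ j ω ≤ ρ (j + 1) ω := fun hρ =>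
    hρ.mono fun ω hω => ⟨hω.1, hω.2.1, fun j hj => (hω.2.2 j hj).le⟩
  filter_upwards [condMSE_sigmaLV_eq (P₀ := P₀) h hind hp hT hi.measurable (hweak hi.grid),
    condMSE_sigmaLV_eq (P₀ := P₀) h hind hp hT hτ.measurable (hweak hτ.grid), hτ.grid, hi.grid]
    with ω hωi hωτ hg hgi
  have hmono := IV_strictMono (hl ω) (h.vs_cont ω) (h.lam_pos ω) (h.vs_pos ω)
  have hsub : ∀ s t, IV lam vs s t ω = IV lam vs 0 t ω - IV lam vs 0 s ω := fun s t => by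
    rw [← IV_add (s := s) (t := t) (hl ω) (h.vs_cont ω), add_sub_cancel_left]
  have hsum : ∀ {ρ : ℕ → Ω → ℝ≥0}, IsGridAt T M ρ ω →
      ∑ j ∈ Finset.range M, IV lam vs (ρ j ω) (ρ (j + 1) ω) ω = IV lam vs 0 T ω := fun {ρ} hρ => by
    rw [Finset.sum_congr rfl fun j _ => hsub (ρ j ω) (ρ (j + 1) ω),
      Finset.sum_range_sub fun j => IV lam vs 0 (ρ j ω) ω, hρ.1, hρ.2.1, IV_self, sub_zero]
  -- IV(0,·) is injective, so equal cumulative values mean equal times.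
  have hequi : ∀ {ρ : ℕ → Ω → ℝ≥0}, IsGridAt T M ρ ω →
      ((∀ j < M, IV lam vs (ρ j ω) (ρ (j + 1) ω) ω = IV lam vs 0 T ω / M) ↔
        ∀ j ≤ M, ρ j ω = iBTS lam vs T M j ω) := fun {ρ} hρ => by
    rw [forall₂_congr fun j (_ : j < M) => by rw [hsub],
      increments_eq_iff (f := fun j => IV lam vs 0 (ρ j ω) ω) (by rw [hρ.1, IV_self])]
    refine forall₂_congr fun j hj => ?_
    rw [← IV_iBTS (hl ω) (h.vs_cont ω) (h.lam_pos ω) (h.vs_pos ω) hT hM hj]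
    exact hmono.injective.eq_iff
  have hiff : ∀ {ρ : ℕ → Ω → ℝ≥0}, IsGridAt T M ρ ω →
      (∑ j ∈ Finset.range M, IV lam vs (ρ j ω) (ρ (j + 1) ω) ω ^ 2 = IV lam vs 0 T ω ^ 2 / M ↔
        ∀ j ≤ M, ρ j ω = iBTS lam vs T M j ω) := fun {ρ} hρ => by
    have := sum_sq_eq_iff (fun j => IV lam vs (ρ j ω) (ρ (j + 1) ω) ω) hM
    rw [hsum hρ] at this
    exact this.trans (hequi hρ)
  have hle := sq_sum_div_le (fun j => IV lam vs (τ j ω) (τ (j + 1) ω) ω) hM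
  rw [hsum hg] at hle
  have hQ0 : 0 ≤ ∫ r in (0 : ℝ)..T, (vs r.toNNReal ω ^ 2) ^ 2 * lam r.toNNReal ω :=
    intervalIntegral.integral_nonneg T.coe_nonneg fun r _ =>
      mul_nonneg (sq_nonneg _) (h.lam_pos _ _).le
  have hV0 : 0 ≤ IV lam vs 0 T ω ^ 2 / M := by positivity
  -- The term with ς⁴λ is common to both schemes; only the sums of squared IV are compared.
  rw [hωi, hωτ, (hiff hgi).2 fun _ _ => rfl]
  refine ⟨ENNReal.ofReal_le_ofReal (by linarith), ?_⟩
  rw [ENNReal.ofReal_eq_ofReal_iff (by linarith) (by linarith), ← hiff hg]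
  constructor <;> intro h <;> linarith

end PartB

end TTSV

/-! ### The theorem -/

theorem mainTheorem2 {Ω : Type*} [MeasurableSpace Ω] (μ : Measure Ω) [IsProbabilityMeasure μ]
    -- the stochastic factors `Z` generating the filtration
    (m : ℕ) (Z : ℝ≥0 → Ω → (Fin m → ℝ)) (hZ : ∀ t, StronglyMeasurable (Z t))
    (P₀ : Ω → ℝ) (lam vs : ℝ≥0 → Ω → ℝ) (N : ℝ≥0 → Ω → ℕ) (B : ℝ≥0 → Ω → ℝ)
    (T : ℝ≥0) (hT : 0 < T) (M : ℕ) (hM : 0 < M)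
    (hmodel : TTSV.IsModel μ (Filtration.natural Z hZ) lam vs N B)
    (hindep : TTSV.IsIndependentNoise μ lam vs N B)
    (hmom : TTSV.HasMoments μ (Filtration.natural Z hZ) lam vs T) :
    -- (a) `(λ, ς, N)`-measurable sampling
    ((∀ j ≤ M, Measurable[TTSV.sigmaLVN lam vs N (Set.Iic T)] (TTSV.rBTS vs N T M j)) ∧
      (∀ ω, 0 < TTSV.rIV vs N 0 T ω →
        TTSV.IsEquidistantRIV vs N T M (TTSV.rBTS vs N T M) ω →
        TTSV.IsGridAt T M (TTSV.rBTS vs N T M) ω) ∧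
      ∀ τ : ℕ → Ω → ℝ≥0,
        TTSV.IsSamplingScheme μ (TTSV.sigmaLVN lam vs N (Set.Iic T)) T M τ →
        ∀ᵐ ω ∂μ,
          -- for every outcome: the lower bound, attained exactly by equidistance in `rIV`
          (ENNReal.ofReal ((TTSV.rIV vs N 0 T ω - TTSV.IV lam vs 0 T ω) ^ 2
                + 2 * TTSV.rIV vs N 0 T ω ^ 2 / M) ≤
              TTSV.condMSE μ (TTSV.sigmaLVN lam vs N (Set.Iic T)) P₀ lam vs N B T M τ ω ∧
            (TTSV.condMSE μ (TTSV.sigmaLVN lam vs N (Set.Iic T)) P₀ lam vs N B T M τ ω =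
              ENNReal.ofReal ((TTSV.rIV vs N 0 T ω - TTSV.IV lam vs 0 T ω) ^ 2
                + 2 * TTSV.rIV vs N 0 T ω ^ 2 / M) ↔
              TTSV.IsEquidistantRIV vs N T M τ ω)) ∧
          -- comparison with realized business time sampling, where it is equidistant in `rIV`
          (0 < TTSV.rIV vs N 0 T ω →
            TTSV.IsEquidistantRIV vs N T M (TTSV.rBTS vs N T M) ω →
            TTSV.condMSE μ (TTSV.sigmaLVN lam vs N (Set.Iic T)) P₀ lam vs N B T M (TTSV.rBTS vs N T M) ω ≤
              TTSV.condMSE μ (TTSV.sigmaLVN lam vs N (Set.Iic T)) P₀ lam vs N B T M τ ω ∧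
            (TTSV.condMSE μ (TTSV.sigmaLVN lam vs N (Set.Iic T)) P₀ lam vs N B T M τ ω =
              TTSV.condMSE μ (TTSV.sigmaLVN lam vs N (Set.Iic T)) P₀ lam vs N B T M (TTSV.rBTS vs N T M) ω ↔
              ∀ j ≤ M, N (τ j ω) ω = N (TTSV.rBTS vs N T M j ω) ω) ∧
            ((∀ j, 0 < j → j < M → TTSV.IsTick N T (τ j ω) ω) →
              (TTSV.condMSE μ (TTSV.sigmaLVN lam vs N (Set.Iic T)) P₀ lam vs N B T M τ ω =
                TTSV.condMSE μ (TTSV.sigmaLVN lam vs N (Set.Iic T)) P₀ lam vs N B T M (TTSV.rBTS vs N T M) ω ↔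
                ∀ j ≤ M, τ j ω = TTSV.rBTS vs N T M j ω)))) ∧
    -- (b) `(λ, ς)`-measurable sampling under the Poisson assumption
    (TTSV.HasPoissonArrivals μ lam vs N →
      TTSV.IsSamplingScheme μ (TTSV.sigmaLV lam vs (Set.Iic T)) T M (TTSV.iBTS lam vs T M) ∧
      ∀ τ : ℕ → Ω → ℝ≥0,
        TTSV.IsSamplingScheme μ (TTSV.sigmaLV lam vs (Set.Iic T)) T M τ →
        ∀ᵐ ω ∂μ,
          TTSV.condMSE μ (TTSV.sigmaLV lam vs (Set.Iic T)) P₀ lam vs N B T M (TTSV.iBTS lam vs T M) ω ≤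
            TTSV.condMSE μ (TTSV.sigmaLV lam vs (Set.Iic T)) P₀ lam vs N B T M τ ω ∧
          (TTSV.condMSE μ (TTSV.sigmaLV lam vs (Set.Iic T)) P₀ lam vs N B T M τ ω =
            TTSV.condMSE μ (TTSV.sigmaLV lam vs (Set.Iic T)) P₀ lam vs N B T M (TTSV.iBTS lam vs T M) ω ↔
            ∀ j ≤ M, τ j ω = TTSV.iBTS lam vs T M j ω)) := by
  have hN := hmodel.counting
  refine ⟨⟨fun j _ => hN.measurable_rBTS
      (fun t ht => TTSV.measurable_N_sigmaLVN ht)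
      (fun t ht => (TTSV.measurable_vs_sigmaLV ht).mono TTSV.sigmaLV_le_sigmaLVN le_rfl)
      hmodel.vs_cont j,
    fun ω hpos heq => hN.isGridAt_rBTS hmodel.vs_pos hM hpos heq, fun τ hτ => ?_⟩,
    fun hp => ⟨hmodel.isSamplingScheme_iBTS hp.lam_cont hT hM, fun τ hτ =>
      TTSV.sampling_given_intensity hmodel hindep hp hT hM hτ⟩⟩
  filter_upwards [TTSV.condMSE_bound (P₀ := P₀) hmodel hindep hT hM hτ.measurable
      (hτ.grid.mono fun ω hω => ⟨hω.1, hω.2.1, fun j hj => (hω.2.2 j hj).le⟩),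
    TTSV.sampling_given_arrivals (P₀ := P₀) hmodel hindep hT hM hτ] with ω h1 h2
  exact ⟨h1, h2⟩
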